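/- Let $\alpha\in[-\infty,+\infty)$ and let $\varphi:\,]\alpha,+\infty[\,\to\mathbb{R}$ be a smooth function with $\dot\varphi>0$ and $\ddot\varphi\ge 0$ on $]\alpha,+\infty[$. Let $\Sigma$ be a smooth surface without boundary (Hausdorff and second countable) and let $f:\Sigma\to\mathbb{R}^3$ be a smooth immersion with $f(\Sigma)\subset\{x\in\mathbb{R}^3:\langle x,e_3\rangle>\alpha\}$, oriented by a smooth unit normal field $N:\Sigma\to\mathbb{R}^3$. Equip $\Sigma$ with the induced metric, its area element $d\Sigma$ and gradient $\nabla$. Let $\mathcal S(v,w)=\langle D_vN,df(w)\rangle$ be the second fundamental form, $H$ its trace with respect to the induced metric (the sum of the principal curvatures), $K$ the Gauss curvature, $|\mathcal S|^2=H^2-2K$, and put $\mu=\langle f,e_3\rangle$, $\eta=\langle N,e_3\rangle$. Suppose that $f$ is $[\varphi,e_3]$-minimal, i.e. $H=-\langle\overline\nabla\varphi,N\rangle=-\dot\varphi(\mu)\,\eta$ on $\Sigma$, where $\overline\nabla\varphi$ is the gradient in $\mathbb{R}^3$ of $x\mapsto\varphi(\langle x,e_3\rangle)$, and that $H\le 0$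 on $\Sigma$. Then $f$ is stable: for every compactly supported smooth function $u:\Sigma\to\mathbb{R}$ the integral $$\mathcal Q_\varphi(u,u)=\int_\Sigma e^{\varphi(\mu)}\Big(|\nabla u|^2-\big(|\mathcal S|^2-\ddot\varphi(\mu)\,\eta^2\big)u^2\Big)\,d\Sigma$$ converges and satisfies $\mathcal Q_\varphi(u,u)\ge 0$. -/

import Mathlib

open scoped Manifold ContDiff RealInnerProductSpace

noncomputable section

namespace PhiMinimal

/-- The Euclidean plane, the model space of surfaces. -/
abbrev E2 : Type := EuclideanSpace ℝ (Fin 2)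

/-- Euclidean three-space. -/
abbrev E3 : Type := EuclideanSpace ℝ (Fin 3)

/-- The vertical unit vector `e₃` (coordinates are indexed by `0, 1, 2`). -/
def e3 : E3 := EuclideanSpace.single 2 1

/-- The part `ℝ³_α = {x : ⟨x, e₃⟩ > α}` of three-space; `α = ⊥` stands for `α = -∞`. -/
def upperRegion (α : WithBot ℝ) : Set E3 := {x | α < ((⟪x, e3⟫ : ℝ) : WithBot ℝ)}

section Surface

variable {M : Type*} [TopologicalSpace M] [ChartedSpace E2 M]

/-- The differential `df_p : T_pM → ℝ³` of a map `f : M → ℝ³`. -/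
def diff (f : M → E3) (p : M) : TangentSpace (𝓡 2) p →L[ℝ] E3 :=
  mfderiv (𝓡 2) (𝓡 3) f p

/-- The differential `du_p : T_pM → ℝ` of a function `u : M → ℝ`. -/
def diffFun (u : M → ℝ) (p : M) : TangentSpace (𝓡 2) p →L[ℝ] ℝ :=
  mfderiv (𝓡 2) 𝓘(ℝ, ℝ) u p

/-- The standard basis of `T_pM`, which is the coordinate basis `∂₁, ∂₂` of the preferred
chart at `p`. -/
def tangentBasis (p : M) : Module.Basis (Fin 2) ℝ (TangentSpace (𝓡 2) p) :=
  (EuclideanSpace.basisFun (Fin 2) ℝ).toBasis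

/-- `f : M → ℝ³` is a smooth immersion oriented by the smooth unit normal field
(Gauss map) `N`. -/
structure IsOrientedImmersion (f N : M → E3) : Prop where
  smooth : ContMDiff (𝓡 2) (𝓡 3) ∞ f
  injective_diff : ∀ p, Function.Injective (diff f p)
  smooth_normal : ContMDiff (𝓡 2) (𝓡 3) ∞ N
  norm_normal : ∀ p, ‖N p‖ = 1
  inner_normal : ∀ p (v : TangentSpace (𝓡 2) p), ⟪diff f p v, N p⟫ = 0

/-- The metric induced by `f` (first fundamental form). -/
def metric (f : M → E3) (p : M) (v w : TangentSpace (𝓡 2) p) : ℝ :=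
  ⟪diff f p v, diff f p w⟫

/-- The second fundamental form `𝒮(v, w) = ⟨D_v N, w⟩`. With this sign the unit sphere has
`𝒮 = metric` for the outer normal. -/
def secondForm (f N : M → E3) (p : M) (v w : TangentSpace (𝓡 2) p) : ℝ :=
  ⟪diff N p v, diff f p w⟫

/-- The matrix `(g_ij)` of the induced metric. -/
def metricMatrix (f : M → E3) (p : M) : Matrix (Fin 2) (Fin 2) ℝ :=
  Matrix.of fun i j => metric f p (tangentBasis p i) (tangentBasis p j)

/-- The matrix `(h_ij)` of the second fundamental form. -/
def secondFormMatrix (f N : M → E3) (p : M) : Matrix (Fin 2) (Fin 2) ℝ :=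
  Matrix.of fun i j => secondForm f N p (tangentBasis p i) (tangentBasis p j)

/-- The matrix `g⁻¹ h` of the endomorphism of `T_pM` that represents `𝒮` with respect to the
induced metric; its eigenvalues are the principal curvatures. -/
def shapeMatrix (f N : M → E3) (p : M) : Matrix (Fin 2) (Fin 2) ℝ :=
  (metricMatrix f p)⁻¹ * secondFormMatrix f N p

/-- The mean curvature `H = k₁ + k₂`, the trace of `𝒮` with respect to the metric. -/
def meanCurvature (f N : M → E3) (p : M) : ℝ := (shapeMatrix f N p).trace

/-- The Gauss curvature `K = k₁ k₂`. -/
def gaussCurvature (f N : M → E3) (p : M) : ℝ := (shapeMatrix f N p).det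

/-- The squared length `|𝒮|² = H² - 2K = k₁² + k₂²` of the second fundamental form. -/
def normSqSecondForm (f N : M → E3) (p : M) : ℝ :=
  meanCurvature f N p ^ 2 - 2 * gaussCurvature f N p

/-- The gradient `∇u` on `M` for the induced metric: `(∇u)ⁱ = g^{ij} ∂_j u`. -/
def surfaceGradient (f : M → E3) (u : M → ℝ) (p : M) : TangentSpace (𝓡 2) p :=
  ∑ i, ((metricMatrix f p)⁻¹.mulVec fun j => diffFun u p (tangentBasis p j)) i •
    tangentBasis p i

/-- The height function `μ = ⟨p, e₃⟩`. -/
def height (f : M → E3) (p : M) : ℝ := ⟪f p, e3⟫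

/-- The angle function `η = ⟨N, e₃⟩`. -/
def angle (N : M → E3) (p : M) : ℝ := ⟪N p, e3⟫

/-- The oriented immersion `(f, N)` is `[φ, e₃]`-minimal: `H = -⟨∇̄φ, N⟩`, where `∇̄φ` is the
gradient in `ℝ³` of `x ↦ φ ⟨x, e₃⟩`. -/
def IsPhiMinimal (φ : ℝ → ℝ) (f N : M → E3) : Prop :=
  ∀ p, meanCurvature f N p = -⟪gradient (fun x : E3 => φ ⟪x, e3⟫) (f p), N p⟫

/-- The area density `√det(⟨∂_i F, ∂_j F⟩)` of the local parametrization `F = f ∘ e⁻¹` given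
by a chart `e`. -/
def areaDensity (f : M → E3) (e : OpenPartialHomeomorph M E2) (y : E2) : ℝ :=
  Real.sqrt (Matrix.of fun i j : Fin 2 =>
    ⟪fderiv ℝ (f ∘ e.symm) y (EuclideanSpace.single i 1),
      fderiv ℝ (f ∘ e.symm) y (EuclideanSpace.single j 1)⟫).det

/-- The area measure on the domain of the chart `e`, extended by zero to `M`:
`s ↦ ∫_{e(s)} √det(g_ij) dy`. -/
def chartArea [MeasurableSpace M] (f : M → E3) (e : OpenPartialHomeomorph M E2) :
    MeasureTheory.Measure M :=
  ((MeasureTheory.volume.restrict e.target).withDensity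
    fun y => ENNReal.ofReal (areaDensity f e y)).map e.symm

/-- The area measure `dΣ` of the immersion `f`: the least measure that dominates all the
measures `chartArea f e`. As these agree on overlaps of charts, it is the measure whose
restriction to each chart domain is the measure with density `√det(g_ij)`. -/
def area [MeasurableSpace M] (f : M → E3) : MeasureTheory.Measure M :=
  ⨆ e ∈ atlas E2 M, chartArea f e

/-- The integrand of the stability form `Q_φ(u, v)`. -/
def stabilityIntegrand (φ : ℝ → ℝ) (f N : M → E3) (u v : M → ℝ) (p : M) : ℝ :=
  Real.exp (φ (height f p)) *
    (metric f p (surfaceGradient f u p) (surfaceGradient f v p) -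
      (normSqSecondForm f N p - deriv (deriv φ) (height f p) * angle N p ^ 2) * (u p * v p))

/-- The stability form
`Q_φ(u, v) = ∫ e^φ (⟨∇u, ∇v⟩ - (|𝒮|² - φ'' η²) u v) dΣ`. -/
def stabilityForm [MeasurableSpace M] (φ : ℝ → ℝ) (f N : M → E3) (u v : M → ℝ) : ℝ :=
  ∫ p, stabilityIntegrand φ f N u v p ∂(area f)

/-- Stability: for every compactly supported smooth `u` the integral `Q_φ(u, u)` converges and
is nonnegative. -/
def IsStable [MeasurableSpace M] (φ : ℝ → ℝ) (f N : M → E3) : Prop :=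
  ∀ u : M → ℝ, ContMDiff (𝓡 2) 𝓘(ℝ, ℝ) ∞ u → HasCompactSupport u →
    MeasureTheory.Integrable (stabilityIntegrand φ f N u u) (area f) ∧
      0 ≤ stabilityForm φ f N u u

end Surface

end PhiMinimal

end

/-! Since `H = -φ'(μ) η` with `φ' > 0`, the condition `H ≤ 0` says that `η ≥ 0`. Vertical
translation leads to the equation `div (e^φ ∇η) + e^φ (|𝒮|² + φ''(1 - η²)) η = 0`, so `η` is a
nonnegative supersolution of the stability operator: the zero order coefficient `|𝒮|² - φ''η²` of
the latter is at most the one here, because `φ'' ≥ 0`. A positive supersolution gives stability by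
the classical test with `u²/η`.

As `η` may vanish, the test function is `u²/(η + ε)`. With `ζ = u/(η + ε)` and `w = η + ε`, the
inequality `⟨∇(ζ²w), ∇w⟩ ≤ |∇(ζw)|²` yields `Q(u, u) ≥ -∫ e^φ u² |𝒮|² ε/(η + ε)`
(`neg_integral_le_stabilityForm`). The right side tends to zero with `ε` by dominated convergence.
Where `η > 0` the quotient tends to zero. Where `η = 0` the function `η` has a minimum, so `dη = 0`;
then `e₃` is tangent and lies in the kernel of the shape operator, so `K = 0`, while `H = -φ'η = 0`,
and `|𝒮|² = H² - 2K` vanishes (`normSqSecondForm_eq_zero`). Thus no maximum principle and no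
connectedness is needed.

The equation for `η` is used only in weak form (`integral_weakIntegrand`). In a chart it comes from
the one-form `β(v) = dη(N × v)`. For the symmetric shape operator `S` and the rotation `J = N ×` one
has `SJ + JS = HJ`, so `β(v)` is the third component of `H N × v - N × dN(v)`. After the
substitution `H = -φ'η`, the curl of `ψ e^φ β` follows from first derivatives and the symmetry of
second derivatives (`divergence_eq`), without Christoffel symbols or the Codazzi equations. A
partition of unity passes from charts to the surface. -/

noncomputable section

namespace PhiMinimal

/-! ### Pointwise algebra of a tangent frame with unit normal -/

/-- The third component of the cross product. -/
def crossThree (X Y : E3) : ℝ := X 0 * Y 1 - X 1 * Y 0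

/-- The triple product `⟨X × Y, Z⟩`. -/
def triple (X Y Z : E3) : ℝ :=
  (X 1 * Y 2 - X 2 * Y 1) * Z 0 + (X 2 * Y 0 - X 0 * Y 2) * Z 1 + (X 0 * Y 1 - X 1 * Y 0) * Z 2

theorem inner_eq_three (X Y : E3) : ⟪X, Y⟫ = X 0 * Y 0 + X 1 * Y 1 + X 2 * Y 2 := by
  simp only [PiLp.inner_apply, Fin.sum_univ_three, RCLike.inner_apply, conj_trivial]
  ring

theorem inner_e3 (X : E3) : ⟪X, e3⟫ = X 2 := by
  simp [inner_eq_three, e3]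

/-- Both `X × Y` and `N` are orthogonal to `X` and `Y`, so `X × Y` is a multiple of the unit vector
`N`. -/
theorem cross_eq_triple_mul {X Y N : E3} (hN : ⟪N, N⟫ = 1) (hX : ⟪X, N⟫ = 0) (hY : ⟪Y, N⟫ = 0) :
    X 1 * Y 2 - X 2 * Y 1 = triple X Y N * N 0 ∧ X 2 * Y 0 - X 0 * Y 2 = triple X Y N * N 1 ∧
      crossThree X Y = triple X Y N * N 2 := by
  rw [inner_eq_three] at hN hX hY
  unfold triple crossThree
  set v0 := X 1 * Y 2 - X 2 * Y 1 with h0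
  set v1 := X 2 * Y 0 - X 0 * Y 2 with h1
  set v2 := X 0 * Y 1 - X 1 * Y 0 with h2
  -- `e0`, `e1`, `e2` are the components of `N × v = 0` with `v = X × Y`; the conclusion is `v = ⟨N,
  -- v⟩N - N × (N × v)`.
  have e2 : N 0 * v1 - N 1 * v0 = 0 := by rw [h0, h1]; linear_combination X 2 * hY - Y 2 * hX
  have e0 : N 1 * v2 - N 2 * v1 = 0 := by rw [h2, h1]; linear_combination X 0 * hY - Y 0 * hX
  have e1 : N 2 * v0 - N 0 * v2 = 0 := by rw [h0, h2]; linear_combination X 1 * hY - Y 1 * hX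
  refine ⟨?_, ?_, ?_⟩
  · linear_combination -v0 * hN - N 1 * e2 + N 2 * e1
  · linear_combination -v1 * hN + N 0 * e2 - N 2 * e0
  · linear_combination -v2 * hN - N 0 * e1 + N 1 * e0

theorem triple_sq {X Y N : E3} (hN : ⟪N, N⟫ = 1) (hX : ⟪X, N⟫ = 0) (hY : ⟪Y, N⟫ = 0) :
    triple X Y N ^ 2 = ⟪X, X⟫ * ⟪Y, Y⟫ - ⟪X, Y⟫ ^ 2 := by
  obtain ⟨h0, h1, h2⟩ := cross_eq_triple_mul hN hX hY
  unfold crossThree at h2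
  have : triple X Y N ^ 2 = (X 1 * Y 2 - X 2 * Y 1) ^ 2 + (X 2 * Y 0 - X 0 * Y 2) ^ 2 +
      (X 0 * Y 1 - X 1 * Y 0) ^ 2 := by
    rw [h0, h1, h2]
    rw [inner_eq_three] at hN
    linear_combination -triple X Y N ^ 2 * hN
  rw [this, inner_eq_three, inner_eq_three, inner_eq_three]
  ring

/-- A vector orthogonal to the normal is the combination of the frame given by Cramer's rule. -/
theorem tangent_decomposition {X Y N W : E3} (hN : ⟪N, N⟫ = 1) (hX : ⟪X, N⟫ = 0)
    (hY : ⟪Y, N⟫ = 0) (hW : ⟪W, N⟫ = 0) (k : Fin 3) :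
    (⟪X, X⟫ * ⟪Y, Y⟫ - ⟪X, Y⟫ ^ 2) * W k =
      (⟪Y, Y⟫ * ⟪W, X⟫ - ⟪X, Y⟫ * ⟪W, Y⟫) * X k + (⟪X, X⟫ * ⟪W, Y⟫ - ⟪X, Y⟫ * ⟪W, X⟫) * Y k := by
  obtain ⟨h0, h1, h2⟩ := cross_eq_triple_mul hN hX hY
  unfold crossThree at h2
  -- For arbitrary `W` the two sides differ by the component of `⟨X × Y, W⟩ X × Y`, which vanishes
  -- here.
  have hc : (X 1 * Y 2 - X 2 * Y 1) * W 0 + (X 2 * Y 0 - X 0 * Y 2) * W 1 +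
      (X 0 * Y 1 - X 1 * Y 0) * W 2 = 0 := by
    rw [h0, h1, h2]
    rw [inner_eq_three] at hW
    linear_combination triple X Y N * hW
  simp only [inner_eq_three]
  fin_cases k
  · simp only [Fin.zero_eta, Fin.isValue]
    linear_combination (X 1 * Y 2 - X 2 * Y 1) * hc
  · simp only [Fin.mk_one, Fin.isValue]
    linear_combination (X 2 * Y 0 - X 0 * Y 2) * hc
  · simp only [Fin.reduceFinMk, Fin.isValue]
    linear_combination (X 0 * Y 1 - X 1 * Y 0) * hc

/-- Third component of `(X × Y) × W = ⟨X, W⟩Y - ⟨Y, W⟩X`, with `X × Y = σN`. It expresses the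
rotation `N ×` in the frame. -/
theorem triple_mul_crossThree_left {X Y N : E3} (hN : ⟪N, N⟫ = 1) (hX : ⟪X, N⟫ = 0)
    (hY : ⟪Y, N⟫ = 0) (W : E3) :
    triple X Y N * crossThree N W = ⟪X, W⟫ * Y 2 - ⟪Y, W⟫ * X 2 := by
  obtain ⟨h0, h1, h2⟩ := cross_eq_triple_mul hN hX hY
  simp only [inner_eq_three]
  unfold crossThree at *
  linear_combination -W 1 * h0 + W 0 * h1

/-- This is `|∇μ|² = 1 - η²`, multiplied by the Gram determinant: `∇μ` is the tangential part of
`e₃`. -/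
theorem gradient_height_sq {X Y N : E3} (hN : ⟪N, N⟫ = 1) (hX : ⟪X, N⟫ = 0) (hY : ⟪Y, N⟫ = 0) :
    ⟪X, X⟫ * Y 2 ^ 2 - 2 * ⟪X, Y⟫ * (X 2 * Y 2) + ⟪Y, Y⟫ * X 2 ^ 2 =
      triple X Y N ^ 2 * (1 - N 2 ^ 2) := by
  obtain ⟨h0, h1, -⟩ := cross_eq_triple_mul hN hX hY
  have h3 : triple X Y N ^ 2 * (1 - N 2 ^ 2) =
      (X 1 * Y 2 - X 2 * Y 1) ^ 2 + (X 2 * Y 0 - X 0 * Y 2) ^ 2 := by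
    rw [h0, h1]
    rw [inner_eq_three] at hN
    linear_combination -triple X Y N ^ 2 * hN
  rw [h3]
  simp only [inner_eq_three]
  ring

/-- The algebra behind the equation `div (e^φ ∇η) = -e^φ (|𝒮|² + φ''(1 - η²)) η`. -/
theorem divergence_algebra {X Y N P Q : E3} (hN : ⟪N, N⟫ = 1) (hX : ⟪X, N⟫ = 0)
    (hY : ⟪Y, N⟫ = 0) {a b c d : ℝ} (hP : ∀ k, P k = a * X k + b * Y k)
    (hQ : ∀ k, Q k = c * X k + d * Y k) (hsymm : ⟪P, Y⟫ = ⟪Q, X⟫)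
    (hD : triple X Y N ≠ 0) {p q ψ ψ₀ ψ₁ G : ℝ} (hH : a + d = -(p * N 2))
    (hG : G * triple X Y N ^ 2 = ⟪Y, Y⟫ * (ψ₀ * P 2) - ⟪X, Y⟫ * (ψ₀ * Q 2 + ψ₁ * P 2) +
      ⟪X, X⟫ * (ψ₁ * Q 2)) {β₀ β₁ : ℝ}
    (hβ₀ : β₀ = -(p * N 2) * crossThree N X - crossThree N P)
    (hβ₁ : β₁ = -(p * N 2) * crossThree N Y - crossThree N Q) :
    (ψ₁ * β₀ - ψ₀ * β₁) + ψ * p * (Y 2 * β₀ - X 2 * β₁) +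
      ψ * (-(q * Y 2 * N 2 + p * Q 2) * crossThree N X + (q * X 2 * N 2 + p * P 2) * crossThree N Y
        - (p * N 2) * (crossThree Q X - crossThree P Y) - (crossThree Q P - crossThree P Q)) =
    triple X Y N *
      (G - ψ * ((a + d) ^ 2 - 2 * (a * d - b * c) + q * (1 - N 2 ^ 2)) * N 2) := by
  have hc := (cross_eq_triple_mul hN hX hY).2.2
  have hNX := triple_mul_crossThree_left hN hX hY X
  have hNY := triple_mul_crossThree_left hN hX hY Y
  rw [real_inner_comm X Y] at hNX
  have hNP : crossThree N P = a * crossThree N X + b * crossThree N Y := by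
    simp only [crossThree, hP]; ring
  have hNQ : crossThree N Q = c * crossThree N X + d * crossThree N Y := by
    simp only [crossThree, hQ]; ring
  have hQX : crossThree Q X = -d * crossThree X Y := by simp only [crossThree, hQ]; ring
  have hPY : crossThree P Y = a * crossThree X Y := by simp only [crossThree, hP]; ring
  have hPQ : crossThree P Q = (a * d - b * c) * crossThree X Y := by
    simp only [crossThree, hP, hQ]; ring
  have hQP : crossThree Q P = -(a * d - b * c) * crossThree X Y := by
    simp only [crossThree, hP, hQ]; ring
  have hs : a * ⟪X, Y⟫ + b * ⟪Y, Y⟫ = c * ⟪X, X⟫ + d * ⟪X, Y⟫ := by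
    have h1 : ⟪P, Y⟫ = a * ⟪X, Y⟫ + b * ⟪Y, Y⟫ := by simp only [inner_eq_three, hP]; ring
    have h2 : ⟪Q, X⟫ = c * ⟪X, X⟫ + d * ⟪X, Y⟫ := by simp only [inner_eq_three, hQ]; ring
    rw [← h1, ← h2, hsymm]
  have hgradμ := gradient_height_sq hN hX hY
  -- Here `SJ + JS = HJ` enters, with `H = a + d` and the symmetry `hs` of the shape operator: `β₀`,
  -- `β₁` are the values of `dη` on `N × X`, `N × Y`.
  have hb₀ : triple X Y N * β₀ = ⟪X, X⟫ * Q 2 - ⟪X, Y⟫ * P 2 := by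
    rw [hβ₀, hNP, ← hH, hP 2, hQ 2]
    linear_combination d * hNX - b * hNY + X 2 * hs
  have hb₁ : triple X Y N * β₁ = ⟪X, Y⟫ * Q 2 - ⟪Y, Y⟫ * P 2 := by
    rw [hβ₁, hNQ, ← hH, hP 2, hQ 2]
    linear_combination -c * hNX + a * hNY + Y 2 * hs
  apply mul_left_cancel₀ hD
  rw [hQX, hPY, hPQ, hQP, hc]
  set σ := triple X Y N
  have key : σ * (Y 2 * crossThree N X - X 2 * crossThree N Y) = σ ^ 2 * (1 - N 2 ^ 2) := by
    rw [← hgradμ]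
    linear_combination Y 2 * hNX - X 2 * hNY
  linear_combination -hG + (ψ₁ + ψ * p * Y 2) * hb₀ - (ψ₀ + ψ * p * X 2) * hb₁ -
    ψ * p * Q 2 * hNX + ψ * p * P 2 * hNY - ψ * q * N 2 * key + σ ^ 2 * ψ * N 2 * (a + d) * hH

/-! ### Parametrized surfaces in coordinates -/

/-- The partial derivative `∂ᵢ h`. -/
def pd {E : Type*} [NormedAddCommGroup E] [NormedSpace ℝ E] (i : Fin 2) (h : E2 → E) (y : E2) : E :=
  fderiv ℝ h y (EuclideanSpace.single i 1)

section pd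

variable {i : Fin 2} {y : E2} {g h : E2 → ℝ}

theorem pd_mul (hg : DifferentiableAt ℝ g y) (hh : DifferentiableAt ℝ h y) :
    pd i (fun z => g z * h z) y = pd i g y * h y + g y * pd i h y := by
  simp only [pd, fderiv_fun_mul hg hh, add_apply, smul_apply, smul_eq_mul]
  ring

theorem pd_add (hg : DifferentiableAt ℝ g y) (hh : DifferentiableAt ℝ h y) :
    pd i (fun z => g z + h z) y = pd i g y + pd i h y := by
  simp [pd, fderiv_fun_add hg hh]

theorem pd_sub (hg : DifferentiableAt ℝ g y) (hh : DifferentiableAt ℝ h y) :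
    pd i (fun z => g z - h z) y = pd i g y - pd i h y := by
  simp [pd, fderiv_fun_sub hg hh]

theorem pd_neg : pd i (fun z => -h z) y = -pd i h y := by
  simp [pd, fderiv_fun_neg]

theorem pd_comp {χ : ℝ → ℝ} (hχ : DifferentiableAt ℝ χ (h y)) (hh : DifferentiableAt ℝ h y) :
    pd i (fun z => χ (h z)) y = deriv χ (h y) * pd i h y := by
  have := (hχ.hasDerivAt.comp_hasFDerivAt y hh.hasFDerivAt).fderiv
  simp only [pd]
  change fderiv ℝ (χ ∘ h) y _ = _
  rw [this]
  simp

theorem pd_apply {F : E2 → E3} (hF : DifferentiableAt ℝ F y) (k : Fin 3) :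
    pd i (fun z => F z k) y = pd i F y k := by
  have h := ((EuclideanSpace.proj (𝕜 := ℝ) k).hasFDerivAt.comp y hF.hasFDerivAt).fderiv
  simp only [pd]
  change fderiv ℝ ((EuclideanSpace.proj (𝕜 := ℝ) k) ∘ F) y _ = _
  rw [h]
  rfl

theorem pd_congr {E : Type*} [NormedAddCommGroup E] [NormedSpace ℝ E] {g h : E2 → E}
    (hgh : g =ᶠ[nhds y] h) : pd i g y = pd i h y := by
  simp only [pd, hgh.fderiv_eq]

theorem pd_inner {F G : E2 → E3} (hF : DifferentiableAt ℝ F y) (hG : DifferentiableAt ℝ G y) :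
    pd i (fun z => ⟪F z, G z⟫) y = ⟪pd i F y, G y⟫ + ⟪F y, pd i G y⟫ := by
  simp only [pd, fderiv_inner_apply ℝ hF hG]
  ring

theorem contDiffAt_pd {E : Type*} [NormedAddCommGroup E] [NormedSpace ℝ E] {F : E2 → E}
    (hF : ContDiffAt ℝ ∞ F y) : ContDiffAt ℝ ∞ (pd i F) y :=
  (hF.fderiv_right (m := ∞) (by simp)).clm_apply contDiffAt_const

theorem pd_pd_comm {E : Type*} [NormedAddCommGroup E] [NormedSpace ℝ E] {F : E2 → E}
    (hF : ContDiffAt ℝ ∞ F y) (i j : Fin 2) : pd i (pd j F) y = pd j (pd i F) y := by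
  have hd : DifferentiableAt ℝ (fderiv ℝ F) y :=
    (hF.fderiv_right (m := ∞) (by simp)).differentiableAt (by simp)
  have key (a b : Fin 2) : pd a (pd b F) y =
      fderiv ℝ (fderiv ℝ F) y (EuclideanSpace.single a 1) (EuclideanSpace.single b 1) := by
    change fderiv ℝ (fun z => fderiv ℝ F z (EuclideanSpace.single b 1)) y _ = _
    rw [fderiv_clm_apply hd (differentiableAt_const _)]
    simp
  rw [key, key]
  exact (hF.isSymmSndFDerivAt (by
    rw [minSmoothness_of_isRCLikeNormedField]
    exact WithTop.coe_le_coe.2 (le_top : (2 : ℕ∞) ≤ ⊤))) _ _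

end pd

/-- The matrix of the first fundamental form of the parametrized surface `F`. -/
def gram (F : E2 → E3) (y : E2) : Matrix (Fin 2) (Fin 2) ℝ :=
  Matrix.of fun i j => ⟪pd i F y, pd j F y⟫

/-- The matrix of the second fundamental form of the parametrized surface `F`. -/
def secondGram (F N : E2 → E3) (y : E2) : Matrix (Fin 2) (Fin 2) ℝ :=
  Matrix.of fun i j => ⟪pd i N y, pd j F y⟫

/-- The inner product of the gradients of `a` and `b` for the first fundamental form of `F`. -/
def gradInner (F : E2 → E3) (a b : E2 → ℝ) (y : E2) : ℝ :=
  (fun i => pd i a y) ⬝ᵥ (gram F y)⁻¹.mulVec fun i => pd i b y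

/-- The mean curvature of a parametrized surface. -/
def coordMean (F N : E2 → E3) (y : E2) : ℝ := ((gram F y)⁻¹ * secondGram F N y).trace

/-- The Gauss curvature of a parametrized surface. -/
def coordGauss (F N : E2 → E3) (y : E2) : ℝ := ((gram F y)⁻¹ * secondGram F N y).det

theorem gram_det (F : E2 → E3) (y : E2) :
    (gram F y).det = ⟪pd 0 F y, pd 0 F y⟫ * ⟪pd 1 F y, pd 1 F y⟫ - ⟪pd 0 F y, pd 1 F y⟫ ^ 2 := by
  rw [Matrix.det_fin_two, gram]
  simp only [Matrix.of_apply]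
  rw [real_inner_comm (pd 0 F y) (pd 1 F y)]
  ring

theorem gradInner_mul_det {F : E2 → E3} {y : E2} (hD : (gram F y).det ≠ 0) (a b : E2 → ℝ) :
    gradInner F a b y * (gram F y).det = ⟪pd 1 F y, pd 1 F y⟫ * (pd 0 a y * pd 0 b y) -
      ⟪pd 0 F y, pd 1 F y⟫ * (pd 0 a y * pd 1 b y + pd 1 a y * pd 0 b y) +
      ⟪pd 0 F y, pd 0 F y⟫ * (pd 1 a y * pd 1 b y) := by
  rw [gradInner, Matrix.inv_def, Matrix.adjugate_fin_two, Ring.inverse_eq_inv']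
  simp only [Matrix.smul_mulVec, dotProduct_smul, smul_eq_mul]
  rw [mul_comm, ← mul_assoc, mul_inv_cancel₀ hD, one_mul]
  simp [Matrix.mulVec, dotProduct, Fin.sum_univ_two, gram]
  rw [real_inner_comm (pd 0 F y) (pd 1 F y)]
  ring

/-- `(F, N)` is a smooth parametrized surface with unit normal on the open set `U`. -/
structure IsParamSurface (U : Set E2) (F N : E2 → E3) : Prop where
  isOpen : IsOpen U
  smooth : ∀ y ∈ U, ContDiffAt ℝ ∞ F y
  smooth_normal : ∀ y ∈ U, ContDiffAt ℝ ∞ N y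
  norm_normal : ∀ y ∈ U, ⟪N y, N y⟫ = 1
  inner_normal : ∀ y ∈ U, ∀ i, ⟪pd i F y, N y⟫ = 0
  det_ne_zero : ∀ y ∈ U, (gram F y).det ≠ 0

namespace IsParamSurface

variable {U : Set E2} {F N : E2 → E3} {y : E2}

/-- The oriented area density `⟨∂₀F × ∂₁F, N⟩`. -/
def orientedArea (F N : E2 → E3) (y : E2) : ℝ := triple (pd 0 F y) (pd 1 F y) (N y)

theorem orientedArea_sq (h : IsParamSurface U F N) (hy : y ∈ U) :
    orientedArea F N y ^ 2 = (gram F y).det := by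
  rw [gram_det]
  exact triple_sq (h.norm_normal y hy) (h.inner_normal y hy 0) (h.inner_normal y hy 1)

theorem inner_pd_normal (h : IsParamSurface U F N) (hy : y ∈ U) (i : Fin 2) :
    ⟪pd i N y, N y⟫ = 0 := by
  have hd := (h.smooth_normal y hy).differentiableAt (by simp)
  have h1 : pd i (fun z => ⟪N z, N z⟫) y = pd i (fun _ => (1 : ℝ)) y :=
    pd_congr (Filter.eventually_of_mem (h.isOpen.mem_nhds hy) h.norm_normal)
  rw [pd_inner hd hd, real_inner_comm (pd i N y) (N y)] at h1
  simp only [pd, fderiv_fun_const, Pi.zero_apply, zero_apply] at h1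
  simp only [pd]
  linarith

/-- Differentiating `⟨∂ⱼF, N⟩ = 0` gives `-⟨∂ᵢ∂ⱼF, N⟩` for the entries, which is symmetric in `i`,
`j`. -/
theorem secondGram_symm (h : IsParamSurface U F N) (hy : y ∈ U) :
    ⟪pd 0 N y, pd 1 F y⟫ = ⟪pd 1 N y, pd 0 F y⟫ := by
  have hd := (h.smooth_normal y hy).differentiableAt (by simp)
  have key (i j : Fin 2) : ⟪pd i (pd j F) y, N y⟫ + ⟪pd j F y, pd i N y⟫ = 0 := by
    have h1 : pd i (fun z => ⟪pd j F z, N z⟫) y = pd i (fun _ => (0 : ℝ)) y :=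
      pd_congr (Filter.eventually_of_mem (h.isOpen.mem_nhds hy)
        (fun z hz => h.inner_normal z hz j))
    rw [pd_inner ((contDiffAt_pd (h.smooth y hy)).differentiableAt (by simp)) hd] at h1
    rw [h1]
    simp [pd]
  have h01 := key 0 1
  have h10 := key 1 0
  rw [pd_pd_comm (h.smooth y hy)] at h01
  rw [real_inner_comm (pd 1 F y), real_inner_comm (pd 0 F y)]
  linarith

/-- The Weingarten equations: the derivatives of the normal in the coordinate frame. -/
theorem weingarten (h : IsParamSurface U F N) (hy : y ∈ U) :
    ∃ a b c d : ℝ, (∀ k, pd 0 N y k = a * pd 0 F y k + b * pd 1 F y k) ∧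
      (∀ k, pd 1 N y k = c * pd 0 F y k + d * pd 1 F y k) ∧
      coordMean F N y = a + d ∧ coordGauss F N y = a * d - b * c := by
  have hD := h.det_ne_zero y hy
  have hD' := hD
  rw [gram_det] at hD
  have dec (i : Fin 2) (k : Fin 3) := tangent_decomposition (h.norm_normal y hy)
    (h.inner_normal y hy 0) (h.inner_normal y hy 1) (h.inner_pd_normal hy i) k
  set D := ⟪pd 0 F y, pd 0 F y⟫ * ⟪pd 1 F y, pd 1 F y⟫ - ⟪pd 0 F y, pd 1 F y⟫ ^ 2
  let A (i : Fin 2) : ℝ := (⟪pd 1 F y, pd 1 F y⟫ * ⟪pd i N y, pd 0 F y⟫ -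
    ⟪pd 0 F y, pd 1 F y⟫ * ⟪pd i N y, pd 1 F y⟫) / D
  let B (i : Fin 2) : ℝ := (⟪pd 0 F y, pd 0 F y⟫ * ⟪pd i N y, pd 1 F y⟫ -
    ⟪pd 0 F y, pd 1 F y⟫ * ⟪pd i N y, pd 0 F y⟫) / D
  have hAB (i : Fin 2) (k : Fin 3) : pd i N y k = A i * pd 0 F y k + B i * pd 1 F y k := by
    have := dec i k
    simp only [A, B]
    field_simp
    linarith
  -- If `A` is the matrix of Weingarten coefficients, then `h = A g`, so `g⁻¹h = g⁻¹ A g` has the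
  -- trace and determinant of `A`.
  have hmat : secondGram F N y = Matrix.of ![![A 0, B 0], ![A 1, B 1]] * gram F y := by
    ext i j
    have : pd i N y = A i • pd 0 F y + B i • pd 1 F y := by ext k; simp [hAB]
    simp only [secondGram, Matrix.of_apply, this, inner_add_left, real_inner_smul_left]
    fin_cases i <;> simp [Matrix.mul_apply, gram]
  refine ⟨A 0, B 0, A 1, B 1, hAB 0, hAB 1, ?_, ?_⟩
  · rw [coordMean, hmat, Matrix.trace_mul_comm, Matrix.mul_assoc,
      Matrix.mul_nonsing_inv _ (isUnit_iff_ne_zero.2 hD'), Matrix.mul_one]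
    simp [Matrix.trace]
  · rw [coordGauss, hmat, Matrix.det_mul, Matrix.det_mul, mul_comm, mul_assoc, ← Matrix.det_mul,
      Matrix.mul_nonsing_inv _ (isUnit_iff_ne_zero.2 hD')]
    simp [Matrix.det_fin_two]

/-- Where `η = 0` and `dη = 0`, the vertical vector is tangent and in the kernel of the shape
operator. -/
theorem coordGauss_eq_zero (h : IsParamSurface U F N) (hy : y ∈ U) (hη : N y 2 = 0)
    (hdη : ∀ i, pd i N y 2 = 0) : coordGauss F N y = 0 := by
  obtain ⟨a, b, c, d, hP, hQ, -, hK⟩ := h.weingarten hy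
  have h0 := hP 2
  have h1 := hQ 2
  rw [hdη] at h0 h1
  rw [hK]
  have hμ := gradient_height_sq (h.norm_normal y hy) (h.inner_normal y hy 0)
    (h.inner_normal y hy 1)
  have hD := h.det_ne_zero y hy
  rw [← h.orientedArea_sq hy] at hD
  -- If `K ≠ 0`, the Weingarten system forces the third components of both frame vectors to vanish.
  -- Then `∇μ = 0`, against `|∇μ|² = 1 - η² = 1`.
  by_contra hne
  have hx : pd 0 F y 2 = 0 := by
    apply mul_left_cancel₀ hne
    linear_combination b * h1 - d * h0
  have hx' : pd 1 F y 2 = 0 := by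
    apply mul_left_cancel₀ hne
    linear_combination c * h0 - a * h1
  rw [hx, hx', hη] at hμ
  apply hD
  rw [orientedArea]
  linarith

end IsParamSurface

/-! ### The divergence identity and its integral in a parameter domain -/

theorem pd_crossThree {i : Fin 2} {y : E2} {A B : E2 → E3} (hA : DifferentiableAt ℝ A y)
    (hB : DifferentiableAt ℝ B y) :
    pd i (fun z => crossThree (A z) (B z)) y =
      crossThree (pd i A y) (B y) + crossThree (A y) (pd i B y) := by
  have hA' := differentiableAt_piLp 2 |>.1 hA
  have hB' := differentiableAt_piLp 2 |>.1 hB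
  simp only [crossThree]
  rw [pd_sub ((hA' 0).fun_mul (hB' 1)) ((hA' 1).fun_mul (hB' 0)), pd_mul (hA' 0) (hB' 1),
    pd_mul (hA' 1) (hB' 0)]
  simp only [pd_apply hA, pd_apply hB]
  ring

theorem integral_pd_eq_zero {Y : E2 → ℝ} (hY : ContDiff ℝ 1 Y) (hc : HasCompactSupport Y)
    (i : Fin 2) : ∫ y, pd i Y y = 0 ∧ MeasureTheory.Integrable (pd i Y) := by
  have hint : MeasureTheory.Integrable (pd i Y) := by
    refine Continuous.integrable_of_hasCompactSupport ?_ ?_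
    · exact (hY.continuous_fderiv (by simp)).clm_apply continuous_const
    · exact (hc.fderiv (𝕜 := ℝ)).comp_left (g := fun L : E2 →L[ℝ] ℝ => L _) (by simp)
  refine ⟨?_, hint⟩
  have := integral_mul_fderiv_eq_neg_fderiv_mul_of_integrable
    (μ := (MeasureTheory.volume : MeasureTheory.Measure E2)) (f := fun _ => (1 : ℝ)) (g := Y)
    (v := EuclideanSpace.single i 1) (by simp)
    (by simp only [one_mul]; exact hint)
    (by simpa using hY.continuous.integrable_of_hasCompactSupport hc)
    (by simp) (fun x _ => hY.differentiable (by simp) x)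
  simpa [pd] using this

namespace IsParamSurface

variable {U : Set E2} {F N : E2 → E3} {y : E2} {φ : ℝ → ℝ}

/-- The coordinates of the one-form `v ↦ dη (N × v)` on a `[φ, e₃]`-minimal surface. -/
def flux (φ : ℝ → ℝ) (F N : E2 → E3) (i : Fin 2) (y : E2) : ℝ :=
  -(deriv φ (F y 2) * N y 2) * crossThree (N y) (pd i F y) - crossThree (N y) (pd i N y)

theorem contDiffAt_comp_height (h : IsParamSurface U F N) (hy : y ∈ U) {χ : ℝ → ℝ}
    (hχ : ContDiffAt ℝ ∞ χ (F y 2)) : ContDiffAt ℝ ∞ (fun z => χ (F z 2)) y :=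
  ContDiffAt.comp y hχ (contDiffAt_piLp 2 |>.1 (h.smooth y hy) 2)

theorem contDiffAt_crossThree {A B : E2 → E3} (hA : ContDiffAt ℝ ∞ A y) (hB : ContDiffAt ℝ ∞ B y) :
    ContDiffAt ℝ ∞ (fun z => crossThree (A z) (B z)) y := by
  have hA' := contDiffAt_piLp 2 |>.1 hA
  have hB' := contDiffAt_piLp 2 |>.1 hB
  exact ((hA' 0).mul (hB' 1)).sub ((hA' 1).mul (hB' 0))

theorem contDiffAt_deriv {χ : ℝ → ℝ} {t : ℝ} (hχ : ContDiffAt ℝ ∞ χ t) :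
    ContDiffAt ℝ ∞ (deriv χ) t := by
  have := (hχ.fderiv_right (m := ∞) (by simp)).clm_apply (contDiffAt_const (c := (1 : ℝ)))
  simpa only [fderiv_apply_one_eq_deriv] using this

theorem contDiffAt_flux (h : IsParamSurface U F N) (hy : y ∈ U) (hφ : ContDiffAt ℝ ∞ φ (F y 2))
    (i : Fin 2) : ContDiffAt ℝ ∞ (flux φ F N i) y := by
  have hN := h.smooth_normal y hy
  have hp := h.contDiffAt_comp_height hy (contDiffAt_deriv hφ)
  have hη := contDiffAt_piLp 2 |>.1 hN 2
  exact ((hp.mul hη).neg.mul (contDiffAt_crossThree hN (contDiffAt_pd (h.smooth y hy)))).sub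
    (contDiffAt_crossThree hN (contDiffAt_pd hN))

/-- Second derivatives of `F` and `N` enter only through `N × ∂ⱼ∂ᵢF` and `N × ∂ⱼ∂ᵢN`, which are
symmetric in `i`, `j` and drop out of the curl. -/
theorem pd_flux (h : IsParamSurface U F N) (hy : y ∈ U) (hφ : ContDiffAt ℝ ∞ φ (F y 2))
    (i j : Fin 2) : pd j (flux φ F N i) y =
      -(deriv (deriv φ) (F y 2) * pd j F y 2 * N y 2 + deriv φ (F y 2) * pd j N y 2) *
          crossThree (N y) (pd i F y)
        - deriv φ (F y 2) * N y 2 *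
          (crossThree (pd j N y) (pd i F y) + crossThree (N y) (pd j (pd i F) y))
        - (crossThree (pd j N y) (pd i N y) + crossThree (N y) (pd j (pd i N) y)) := by
  have hF := h.smooth y hy
  have hN := h.smooth_normal y hy
  have hp' := contDiffAt_deriv hφ
  have hp := h.contDiffAt_comp_height hy hp'
  have hη := contDiffAt_piLp 2 |>.1 hN 2
  have hx := contDiffAt_piLp 2 |>.1 hF 2
  have hcF := contDiffAt_crossThree hN (contDiffAt_pd (i := i) hF)
  have hcN := contDiffAt_crossThree hN (contDiffAt_pd (i := i) hN)
  have hnz : (∞ : ℕ∞ω) ≠ 0 := by simp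
  have dF := hF.differentiableAt hnz
  have dN := hN.differentiableAt hnz
  have hprod := hp.mul hη
  unfold flux
  rw [pd_sub ((hprod.neg.mul hcF).differentiableAt hnz) (hcN.differentiableAt hnz),
    pd_mul (hprod.neg.differentiableAt hnz) (hcF.differentiableAt hnz), pd_neg,
    pd_mul (hp.differentiableAt hnz) (hη.differentiableAt hnz),
    pd_comp (hp'.differentiableAt hnz) (hx.differentiableAt hnz),
    pd_crossThree dN ((contDiffAt_pd hF).differentiableAt hnz),
    pd_crossThree dN ((contDiffAt_pd hN).differentiableAt hnz), pd_apply dF, pd_apply dN]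
  ring

/-- The weak form of `div (e^φ ∇η) + e^φ (|𝒮|² + φ''(1 - η²)) η = 0` tested against `ψ`. -/
def weakTerm (φ : ℝ → ℝ) (F N : E2 → E3) (ψ : E2 → ℝ) (y : E2) : ℝ :=
  Real.exp (φ (F y 2)) * (gradInner F ψ (fun z => N z 2) y -
    ψ y * (coordMean F N y ^ 2 - 2 * coordGauss F N y +
      deriv (deriv φ) (F y 2) * (1 - N y 2 ^ 2)) * N y 2)

/-- The left side is, up to sign, the exterior derivative of `ψ e^φ β`; the weak equation for `η` is
thus an exact form in the chart. -/
theorem divergence_eq (h : IsParamSurface U F N) (hy : y ∈ U) (hφ : ContDiffAt ℝ ∞ φ (F y 2))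
    (hH : coordMean F N y = -(deriv φ (F y 2) * N y 2)) {ψ : E2 → ℝ} (hψ : ContDiffAt ℝ ∞ ψ y) :
    pd 1 (fun z => ψ z * Real.exp (φ (F z 2)) * flux φ F N 0 z) y -
      pd 0 (fun z => ψ z * Real.exp (φ (F z 2)) * flux φ F N 1 z) y =
    orientedArea F N y * weakTerm φ F N ψ y := by
  have hnz : (∞ : ℕ∞ω) ≠ 0 := by simp
  have dF := (h.smooth y hy).differentiableAt hnz
  have dN := (h.smooth_normal y hy).differentiableAt hnz
  have hx := differentiableAt_piLp 2 |>.1 dF 2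
  have hφx := h.contDiffAt_comp_height hy hφ
  have hexp (i : Fin 2) : pd i (fun z => Real.exp (φ (F z 2))) y =
      Real.exp (φ (F y 2)) * (deriv φ (F y 2) * pd i F y 2) := by
    rw [pd_comp (χ := Real.exp) (h := fun z => φ (F z 2)) Real.differentiableAt_exp
      (hφx.differentiableAt hnz), pd_comp (hφ.differentiableAt hnz) hx, pd_apply dF,
      Real.deriv_exp]
  have hE : ContDiffAt ℝ ∞ (fun z => Real.exp (φ (F z 2))) y := hφx.exp
  have hprod (i j : Fin 2) : pd j (fun z => ψ z * Real.exp (φ (F z 2)) * flux φ F N i z) y =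
      (pd j ψ y * Real.exp (φ (F y 2)) + ψ y * (Real.exp (φ (F y 2)) *
        (deriv φ (F y 2) * pd j F y 2))) * flux φ F N i y +
      ψ y * Real.exp (φ (F y 2)) * pd j (flux φ F N i) y := by
    rw [pd_mul ((hψ.mul hE).differentiableAt hnz)
      ((h.contDiffAt_flux hy hφ i).differentiableAt hnz),
      pd_mul (hψ.differentiableAt hnz) (hE.differentiableAt hnz), hexp]
  obtain ⟨a, b, c, d, hP, hQ, hHm, hK⟩ := h.weingarten hy
  have hD := h.det_ne_zero y hy
  have hσ : triple (pd 0 F y) (pd 1 F y) (N y) ≠ 0 := by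
    intro h0
    rw [← h.orientedArea_sq hy, orientedArea, h0] at hD
    simp at hD
  have hG := gradInner_mul_det hD ψ (fun z => N z 2)
  rw [← h.orientedArea_sq hy] at hG
  simp only [pd_apply dN] at hG
  have key := divergence_algebra (h.norm_normal y hy) (h.inner_normal y hy 0)
    (h.inner_normal y hy 1) hP hQ (h.secondGram_symm hy) hσ (p := deriv φ (F y 2))
    (q := deriv (deriv φ) (F y 2)) (ψ := ψ y) (hHm ▸ hH) hG (β₀ := flux φ F N 0 y)
    (β₁ := flux φ F N 1 y) rfl rfl
  rw [← hHm, ← hK] at key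
  rw [hprod, hprod, h.pd_flux hy hφ, h.pd_flux hy hφ, weakTerm, pd_pd_comm (h.smooth y hy) 0 1,
    pd_pd_comm (h.smooth_normal y hy) 0 1, orientedArea]
  linear_combination Real.exp (φ (F y 2)) * key

theorem gram_det_pos (h : IsParamSurface U F N) (hy : y ∈ U) : 0 < (gram F y).det := by
  rw [← h.orientedArea_sq hy]
  have := h.det_ne_zero y hy
  rw [← h.orientedArea_sq hy] at this
  positivity

theorem contDiffAt_orientedArea (h : IsParamSurface U F N) (hy : y ∈ U) :
    ContDiffAt ℝ ∞ (orientedArea F N) y := by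
  have h0 := contDiffAt_piLp 2 |>.1 (contDiffAt_pd (i := 0) (h.smooth y hy))
  have h1 := contDiffAt_piLp 2 |>.1 (contDiffAt_pd (i := 1) (h.smooth y hy))
  have hN := contDiffAt_piLp 2 |>.1 (h.smooth_normal y hy)
  unfold orientedArea triple
  exact (((((h0 1).mul (h1 2)).sub ((h0 2).mul (h1 1))).mul (hN 0)).add
    ((((h0 2).mul (h1 0)).sub ((h0 0).mul (h1 2))).mul (hN 1))).add
    ((((h0 0).mul (h1 1)).sub ((h0 1).mul (h1 0))).mul (hN 2))

/-- The orientation sign is locally constant. -/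
theorem sign_orientedArea_eventuallyEq (h : IsParamSurface U F N) (hy : y ∈ U) :
    (fun z => SignType.sign (orientedArea F N z)) =ᶠ[nhds y]
      fun _ => SignType.sign (orientedArea F N y) := by
  have hc := (h.contDiffAt_orientedArea hy).continuousAt
  have hne : orientedArea F N y ≠ 0 := by
    intro h0
    have := h.gram_det_pos hy
    rw [← h.orientedArea_sq hy, h0] at this
    simp at this
  rcases lt_or_gt_of_ne hne with hlt | hgt
  · filter_upwards [hc.eventually_lt_const hlt] with z hz
    rw [sign_neg hz, sign_neg hlt]
  · filter_upwards [hc.eventually_const_lt hgt] with z hz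
    rw [sign_pos hz, sign_pos hgt]

/-- Stokes' theorem for the compactly supported form `ψ e^φ β`. The divergence identity carries the
oriented density, the integral the unsigned one; a locally constant sign reconciles them. -/
theorem integral_weakTerm (h : IsParamSurface U F N)
    (hφ : ∀ y ∈ U, ContDiffAt ℝ ∞ φ (F y 2))
    (hH : ∀ y ∈ U, coordMean F N y = -(deriv φ (F y 2) * N y 2)) {ψ : E2 → ℝ}
    (hψ : ∀ y ∈ U, ContDiffAt ℝ ∞ ψ y) {K : Set E2} (hK : IsCompact K) (hKU : K ⊆ U)
    (hψK : ∀ y ∉ K, ψ y = 0) :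
    ∫ y in U, Real.sqrt (gram F y).det * weakTerm φ F N ψ y = 0 := by
  -- The chart may disagree with the orientation given by `N`, differently on different components
  -- of `U`. The choice gives `s σ = |σ| = √det g`.
  let s : E2 → ℝ := fun y => (SignType.sign (orientedArea F N y) : ℝ)
  let X (i : Fin 2) : E2 → ℝ := fun z => ψ z * Real.exp (φ (F z 2)) * flux φ F N i z
  let Y (i : Fin 2) : E2 → ℝ := fun z => s z * X i z
  have hX0 (i : Fin 2) : ∀ y ∉ K, Y i y = 0 := fun y hy => by simp [Y, X, hψK y hy]
  have hXsm (i : Fin 2) : ∀ y ∈ U, ContDiffAt ℝ ∞ (X i) y := fun y hy =>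
    ((hψ y hy).mul (h.contDiffAt_comp_height hy (hφ y hy)).exp).mul
      (h.contDiffAt_flux hy (hφ y hy) i)
  have hYeq (i : Fin 2) : ∀ y ∈ U, Y i =ᶠ[nhds y] fun z => s y * X i z := fun y hy => by
    filter_upwards [h.sign_orientedArea_eventuallyEq hy] with z hz
    simp only [Y, s, hz]
  have hYzero (i : Fin 2) : ∀ y ∉ K, Y i =ᶠ[nhds y] fun _ => 0 := fun y hy =>
    Filter.eventually_of_mem (hK.isClosed.isOpen_compl.mem_nhds hy) (hX0 i)
  have hYsm (i : Fin 2) : ContDiff ℝ 1 (Y i) := by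
    rw [contDiff_iff_contDiffAt]
    intro y
    -- Near points of `K ⊆ U` the function is smooth with constant sign; on the open complement of
    -- `K` it is zero, whatever `F` and `N` are outside `U`.
    by_cases hy : y ∈ K
    · exact ((contDiffAt_const.mul (hXsm i y (hKU hy))).of_le (by simp)).congr_of_eventuallyEq
        (hYeq i y (hKU hy))
    · exact contDiffAt_const.congr_of_eventuallyEq (hYzero i y hy)
  have hYc (i : Fin 2) : HasCompactSupport (Y i) := HasCompactSupport.intro hK (hX0 i)
  have hpd (i j : Fin 2) : ∀ y ∈ U, pd j (Y i) y = s y * pd j (X i) y := fun y hy => by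
    rw [pd_congr (hYeq i y hy), pd_mul (differentiableAt_const _)
      ((hXsm i y hy).differentiableAt (by simp))]
    simp [pd]
  have hdiv : ∀ y ∈ U, Real.sqrt (gram F y).det * weakTerm φ F N ψ y =
      pd 1 (Y 0) y - pd 0 (Y 1) y := fun y hy => by
    rw [hpd 0 1 y hy, hpd 1 0 y hy, ← mul_sub, h.divergence_eq hy (hφ y hy) (hH y hy) (hψ y hy),
      ← mul_assoc, ← h.orientedArea_sq hy, Real.sqrt_sq_eq_abs]
    simp only [s, sign_mul_self]
  rw [MeasureTheory.setIntegral_congr_fun h.isOpen.measurableSet hdiv,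
    MeasureTheory.setIntegral_eq_integral_of_forall_compl_eq_zero]
  · obtain ⟨h0, i0⟩ := integral_pd_eq_zero (hYsm 0) (hYc 0) 1
    obtain ⟨h1, i1⟩ := integral_pd_eq_zero (hYsm 1) (hYc 1) 0
    rw [MeasureTheory.integral_sub i0 i1, h0, h1, sub_zero]
  · intro y hy
    have hyK : y ∉ K := fun hyK => hy (hKU hyK)
    rw [pd_congr (hYzero 0 y hyK), pd_congr (hYzero 1 y hyK)]
    simp [pd]

end IsParamSurface

/-! ### Geometric quantities in a chart -/

section Chart

variable {M : Type*} [TopologicalSpace M] [ChartedSpace E2 M]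

/-- A vector in the kernel of the Gram matrix is the coordinate vector of some `w` with `|df(w)|² =
0`. -/
theorem metricMatrix_det_ne_zero {f N : M → E3} (hf : IsOrientedImmersion f N) (p : M) :
    (metricMatrix f p).det ≠ 0 := by
  intro h0
  obtain ⟨v, hv, hv0⟩ := Matrix.exists_mulVec_eq_zero_iff.2 h0
  let w : TangentSpace (𝓡 2) p := ∑ i, v i • tangentBasis p i
  have hsum : ⟪diff f p w, diff f p w⟫ = v ⬝ᵥ (metricMatrix f p).mulVec v := by
    simp only [w, map_add, map_smul, inner_add_left, inner_add_right, real_inner_smul_left,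
      real_inner_smul_right, dotProduct, Matrix.mulVec, metricMatrix, metric, Matrix.of_apply,
      Fin.sum_univ_two]
    ring
  rw [hv0, dotProduct_zero, inner_self_eq_zero] at hsum
  have hw : w = 0 := hf.injective_diff p (by rw [hsum, map_zero])
  apply hv
  have := (Fintype.linearIndependent_iff.1 (tangentBasis p).linearIndependent) v hw
  exact funext this

/-- From `g⁻¹ g g⁻¹ = g⁻¹` and the symmetry of `g`. This form is visibly bilinear in `du`, `dv` and
easy to transform between charts. -/
theorem metric_gradient_eq_dotProduct {f N : M → E3} (hf : IsOrientedImmersion f N)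
    (u v : M → ℝ) (p : M) : metric f p (surfaceGradient f u p) (surfaceGradient f v p) =
      (fun j => diffFun u p (tangentBasis p j)) ⬝ᵥ
        (metricMatrix f p)⁻¹.mulVec fun j => diffFun v p (tangentBasis p j) := by
  have hbil (a b : Fin 2 → ℝ) : metric f p (∑ i, a i • tangentBasis p i)
      (∑ i, b i • tangentBasis p i) = a ⬝ᵥ (metricMatrix f p).mulVec b := by
    simp only [map_add, map_smul, inner_add_left, inner_add_right, real_inner_smul_left,
      real_inner_smul_right, dotProduct, Matrix.mulVec, metricMatrix, metric, Matrix.of_apply,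
      Fin.sum_univ_two]
    ring
  have hsymm : (metricMatrix f p).transpose = metricMatrix f p := by
    ext i j
    simp only [Matrix.transpose_apply, metricMatrix, Matrix.of_apply, metric]
    exact real_inner_comm _ _
  rw [surfaceGradient, surfaceGradient, hbil, Matrix.mulVec_mulVec,
    Matrix.mul_nonsing_inv _ (isUnit_iff_ne_zero.2 (metricMatrix_det_ne_zero hf p)),
    Matrix.one_mulVec, dotProduct_comm, Matrix.dotProduct_mulVec,
    ← Matrix.mulVec_transpose, Matrix.transpose_nonsing_inv, hsymm]
  exact dotProduct_comm _ _

variable [IsManifold (𝓡 2) ∞ M] {e : OpenPartialHomeomorph M E2} {p : M}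
  {E : Type*} [NormedAddCommGroup E] [NormedSpace ℝ E]

theorem contDiffAt_chart (he : e ∈ atlas E2 M) {h : M → E} (hh : ContMDiff (𝓡 2) 𝓘(ℝ, E) ∞ h)
    {y : E2} (hy : y ∈ e.target) : ContDiffAt ℝ ∞ (h ∘ e.symm) y := by
  have h1 : ContMDiffOn (𝓡 2) (𝓡 2) ∞ e.symm e.target :=
    contMDiffOn_symm_of_mem_maximalAtlas (IsManifold.subset_maximalAtlas he)
  have h2 := (hh.comp_contMDiffOn h1).contMDiffAt (e.open_target.mem_nhds hy)
  exact h2.contDiffAt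

theorem mfderiv_eq_fderiv_chart (he : e ∈ atlas E2 M) {h : M → E}
    (hh : ContMDiff (𝓡 2) 𝓘(ℝ, E) ∞ h) (hp : p ∈ e.source) (v : TangentSpace (𝓡 2) p) :
    mfderiv (𝓡 2) 𝓘(ℝ, E) h p v =
      fderiv ℝ (h ∘ e.symm) (e p) (mfderiv (𝓡 2) (𝓡 2) e p v) := by
  have heq : h =ᶠ[nhds p] (h ∘ e.symm) ∘ e :=
    Filter.eventually_of_mem (e.open_source.mem_nhds hp) fun q hq => by simp [e.left_inv hq]
  have hd : DifferentiableAt ℝ (h ∘ e.symm) (e p) :=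
    (contDiffAt_chart he hh (e.map_source hp)).differentiableAt (by simp)
  have hed : MDifferentiableAt (𝓡 2) (𝓡 2) e p :=
    mdifferentiableAt_atlas he hp
  rw [heq.mfderiv_eq, mfderiv_comp p hd.mdifferentiableAt hed, mfderiv_eq_fderiv]
  rfl

/-- The differential of the chart `e` at `p`. -/
def chartDiff (e : OpenPartialHomeomorph M E2) (p : M) : TangentSpace (𝓡 2) p →L[ℝ] E2 :=
  mfderiv (𝓡 2) (𝓡 2) e p

/-- The matrix of the differential of the chart `e` at `p`, in the standard basis of `T_pM`. -/
def chartMatrix (e : OpenPartialHomeomorph M E2) (p : M) : Matrix (Fin 2) (Fin 2) ℝ :=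
  Matrix.of fun i j => chartDiff e p (tangentBasis p j) i

theorem chartMatrix_det_ne_zero (he : e ∈ atlas E2 M) (hp : p ∈ e.source) :
    (chartMatrix e p).det ≠ 0 := by
  have hb := (mdifferentiable_of_mem_atlas (I := 𝓡 2) he).mfderiv_bijective hp
  let L : E2 →ₗ[ℝ] E2 := (chartDiff e p).toLinearMap
  have hL : Function.Bijective L := hb
  have hm : chartMatrix e p = LinearMap.toMatrix (EuclideanSpace.basisFun (Fin 2) ℝ).toBasis
      (EuclideanSpace.basisFun (Fin 2) ℝ).toBasis L := by
    ext i j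
    rw [LinearMap.toMatrix_apply]
    rfl
  rw [hm, LinearMap.det_toMatrix]
  exact (LinearEquiv.isUnit_det' (LinearEquiv.ofBijective L hL)).ne_zero

theorem mfderiv_tangentBasis (he : e ∈ atlas E2 M) {h : M → E}
    (hh : ContMDiff (𝓡 2) 𝓘(ℝ, E) ∞ h) (hp : p ∈ e.source) (j : Fin 2) :
    mfderiv (𝓡 2) 𝓘(ℝ, E) h p (tangentBasis p j) =
      ∑ i, chartMatrix e p i j • pd i (h ∘ e.symm) (e p) := by
  have hv : chartDiff e p (tangentBasis p j) =
      ∑ i, chartMatrix e p i j • EuclideanSpace.single i (1 : ℝ) := by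
    ext k
    fin_cases k <;> simp [chartMatrix, Fin.sum_univ_two]
  rw [mfderiv_eq_fderiv_chart he hh hp]
  refine (congrArg (fderiv ℝ (h ∘ e.symm) (e p)) hv).trans ?_
  rw [map_sum]
  simp only [map_smul]
  rfl

theorem metricMatrix_eq (he : e ∈ atlas E2 M) {f : M → E3} (hf : ContMDiff (𝓡 2) (𝓡 3) ∞ f)
    (hp : p ∈ e.source) : metricMatrix f p =
      (chartMatrix e p).transpose * gram (f ∘ e.symm) (e p) * chartMatrix e p := by
  ext i j
  simp only [metricMatrix, metric, diff, Matrix.of_apply, Matrix.mul_apply, gram,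
    Matrix.transpose_apply]
  erw [mfderiv_tangentBasis he hf hp, mfderiv_tangentBasis he hf hp]
  simp only [Fin.sum_univ_two, inner_add_left, inner_add_right, real_inner_smul_left,
    real_inner_smul_right]
  ring

theorem secondFormMatrix_eq (he : e ∈ atlas E2 M) {f N : M → E3}
    (hf : ContMDiff (𝓡 2) (𝓡 3) ∞ f) (hN : ContMDiff (𝓡 2) (𝓡 3) ∞ N)
    (hp : p ∈ e.source) : secondFormMatrix f N p =
      (chartMatrix e p).transpose * secondGram (f ∘ e.symm) (N ∘ e.symm) (e p) *
        chartMatrix e p := by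
  ext i j
  simp only [secondFormMatrix, secondForm, diff, Matrix.of_apply, Matrix.mul_apply, secondGram,
    Matrix.transpose_apply]
  erw [mfderiv_tangentBasis he hf hp, mfderiv_tangentBasis he hN hp]
  simp only [Fin.sum_univ_two, inner_add_left, inner_add_right, real_inner_smul_left,
    real_inner_smul_right]
  ring

theorem diffFun_eq (he : e ∈ atlas E2 M) {u : M → ℝ} (hu : ContMDiff (𝓡 2) 𝓘(ℝ, ℝ) ∞ u)
    (hp : p ∈ e.source) : (fun j => diffFun u p (tangentBasis p j)) =
      (chartMatrix e p).transpose.mulVec fun i => pd i (u ∘ e.symm) (e p) := by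
  ext j
  simp only [diffFun]
  erw [mfderiv_tangentBasis he hu hp]
  simp [Matrix.mulVec, dotProduct, Fin.sum_univ_two]

theorem isParamSurface (he : e ∈ atlas E2 M) {f N : M → E3} (hf : IsOrientedImmersion f N) :
    IsParamSurface e.target (f ∘ e.symm) (N ∘ e.symm) where
  isOpen := e.open_target
  smooth _ hy := contDiffAt_chart he hf.smooth hy
  smooth_normal _ hy := contDiffAt_chart he hf.smooth_normal hy
  norm_normal y _ := by
    rw [real_inner_self_eq_norm_sq, Function.comp_apply, hf.norm_normal, one_pow]
  inner_normal y hy i := by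
    have hp := e.map_target hy
    obtain ⟨v, hv⟩ := ((mdifferentiable_of_mem_atlas (I := 𝓡 2) he).mfderiv_bijective hp).2
      (EuclideanSpace.single i 1 : E2)
    have h1 := hf.inner_normal (e.symm y) v
    have h2 : diff f (e.symm y) v = pd i (f ∘ e.symm) y := by
      refine (mfderiv_eq_fderiv_chart he hf.smooth hp v).trans ?_
      rw [hv, pd, e.right_inv hy]
    rw [h2] at h1
    exact h1
  det_ne_zero y hy h0 := by
    have hp := e.map_target hy
    apply metricMatrix_det_ne_zero hf (e.symm y)
    rw [metricMatrix_eq he hf.smooth hp, Matrix.det_mul, Matrix.det_mul, e.right_inv hy, h0]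
    simp

/-- `g` and `h` both change by congruence with the chart matrix, so `g⁻¹h` changes by conjugation
and its trace and determinant can be computed in any chart. -/
theorem shapeMatrix_eq (he : e ∈ atlas E2 M) {f N : M → E3} (hf : IsOrientedImmersion f N)
    (hp : p ∈ e.source) : shapeMatrix f N p = (chartMatrix e p)⁻¹ *
      ((gram (f ∘ e.symm) (e p))⁻¹ * secondGram (f ∘ e.symm) (N ∘ e.symm) (e p)) *
        chartMatrix e p := by
  have hP := isUnit_iff_ne_zero.2 (chartMatrix_det_ne_zero he hp)
  have hPt : IsUnit (chartMatrix e p).transpose.det := by rwa [Matrix.det_transpose]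
  rw [shapeMatrix, metricMatrix_eq he hf.smooth hp,
    secondFormMatrix_eq he hf.smooth hf.smooth_normal hp, Matrix.mul_inv_rev, Matrix.mul_inv_rev]
  simp only [Matrix.mul_assoc]
  rw [Matrix.nonsing_inv_mul_cancel_left _ _ hPt]

theorem meanCurvature_eq (he : e ∈ atlas E2 M) {f N : M → E3} (hf : IsOrientedImmersion f N)
    (hp : p ∈ e.source) :
    meanCurvature f N p = coordMean (f ∘ e.symm) (N ∘ e.symm) (e p) := by
  rw [meanCurvature, shapeMatrix_eq he hf hp, Matrix.mul_assoc, Matrix.trace_mul_comm,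
    Matrix.mul_assoc, Matrix.mul_nonsing_inv _
      (isUnit_iff_ne_zero.2 (chartMatrix_det_ne_zero he hp)), Matrix.mul_one, coordMean]

theorem gaussCurvature_eq (he : e ∈ atlas E2 M) {f N : M → E3} (hf : IsOrientedImmersion f N)
    (hp : p ∈ e.source) :
    gaussCurvature f N p = coordGauss (f ∘ e.symm) (N ∘ e.symm) (e p) := by
  rw [gaussCurvature, shapeMatrix_eq he hf hp, Matrix.det_mul, mul_comm, ← Matrix.det_mul,
    Matrix.mul_nonsing_inv_cancel_left _ _
      (isUnit_iff_ne_zero.2 (chartMatrix_det_ne_zero he hp)), coordGauss]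

theorem metric_gradient_eq (he : e ∈ atlas E2 M) {f N : M → E3} (hf : IsOrientedImmersion f N)
    {u v : M → ℝ} (hu : ContMDiff (𝓡 2) 𝓘(ℝ, ℝ) ∞ u) (hv : ContMDiff (𝓡 2) 𝓘(ℝ, ℝ) ∞ v)
    (hp : p ∈ e.source) : metric f p (surfaceGradient f u p) (surfaceGradient f v p) =
      gradInner (f ∘ e.symm) (u ∘ e.symm) (v ∘ e.symm) (e p) := by
  have hP := isUnit_iff_ne_zero.2 (chartMatrix_det_ne_zero he hp)
  have hPt : IsUnit (chartMatrix e p).transpose.det := by rwa [Matrix.det_transpose]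
  rw [metric_gradient_eq_dotProduct hf, diffFun_eq he hu hp, diffFun_eq he hv hp,
    metricMatrix_eq he hf.smooth hp, Matrix.mulVec_mulVec, Matrix.mul_inv_rev, Matrix.mul_inv_rev,
    Matrix.mul_assoc, Matrix.mul_assoc, Matrix.nonsing_inv_mul _ hPt, Matrix.mul_one,
    Matrix.mulVec_transpose, ← Matrix.dotProduct_mulVec, Matrix.mulVec_mulVec,
    Matrix.mul_nonsing_inv_cancel_left _ _ hP, gradInner]

end Chart

/-! ### The area measure in a chart -/

section Area

open MeasureTheory

theorem det_gram_comp {F : E2 → E3} {τ : E2 → E2} {y : E2} (hF : DifferentiableAt ℝ F (τ y))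
    (hτ : DifferentiableAt ℝ τ y) :
    (gram (F ∘ τ) y).det = (fderiv ℝ τ y).det ^ 2 * (gram F (τ y)).det := by
  let T := LinearMap.toMatrix (EuclideanSpace.basisFun (Fin 2) ℝ).toBasis
    (EuclideanSpace.basisFun (Fin 2) ℝ).toBasis (fderiv ℝ τ y : E2 →ₗ[ℝ] E2)
  have hpd (j : Fin 2) : pd j (F ∘ τ) y = ∑ i, T i j • pd i F (τ y) := by
    have hv : fderiv ℝ τ y (EuclideanSpace.single j 1) =
        ∑ i, T i j • EuclideanSpace.single i (1 : ℝ) := by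
      ext k
      fin_cases k <;> simp [T, LinearMap.toMatrix_apply, Fin.sum_univ_two]
    rw [pd, fderiv_comp y hF hτ, ContinuousLinearMap.comp_apply, hv, map_sum]
    simp only [map_smul]
    rfl
  have hg : gram (F ∘ τ) y = T.transpose * gram F (τ y) * T := by
    ext i j
    simp only [gram, Matrix.of_apply, hpd, Matrix.mul_apply, Matrix.transpose_apply,
      Fin.sum_univ_two, inner_add_left, inner_add_right, real_inner_smul_left,
      real_inner_smul_right]
    ring
  have hT : T.det = (fderiv ℝ τ y).det := LinearMap.det_toMatrix _ _
  rw [hg, Matrix.det_mul, Matrix.det_mul, Matrix.det_transpose, hT]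
  ring

variable {M : Type*} [TopologicalSpace M]
  {e e' : OpenPartialHomeomorph M E2} {f N : M → E3}

theorem areaDensity_eq (f : M → E3) (e : OpenPartialHomeomorph M E2) (y : E2) :
    areaDensity f e y = Real.sqrt (gram (f ∘ e.symm) y).det := rfl

section Density

variable [ChartedSpace E2 M] [IsManifold (𝓡 2) ∞ M]

theorem contDiffAt_transition (he : e ∈ atlas E2 M) (he' : e' ∈ atlas E2 M) {y : E2}
    (hy : y ∈ e.target) (hy' : e.symm y ∈ e'.source) : ContDiffAt ℝ ∞ (e' ∘ e.symm) y := by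
  have h1 : ContMDiffAt (𝓡 2) (𝓡 2) ∞ e.symm y :=
    (contMDiffOn_symm_of_mem_maximalAtlas (IsManifold.subset_maximalAtlas he)).contMDiffAt
      (e.open_target.mem_nhds hy)
  have h2 : ContMDiffAt (𝓡 2) (𝓡 2) ∞ e' (e.symm y) :=
    contMDiffAt_of_mem_maximalAtlas (IsManifold.subset_maximalAtlas he') hy'
  exact (h2.comp y h1).contDiffAt

/-- The Gram determinant picks up the squared Jacobian of the transition map; its root is the factor
in the change of variables formula. -/
theorem areaDensity_transition (hf : ContMDiff (𝓡 2) (𝓡 3) ∞ f) (he : e ∈ atlas E2 M)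
    (he' : e' ∈ atlas E2 M) {y : E2} (hy : y ∈ e.target) (hy' : e.symm y ∈ e'.source) :
    areaDensity f e y =
      |(fderiv ℝ (e' ∘ e.symm) y).det| * areaDensity f e' ((e' ∘ e.symm) y) := by
  have heq : f ∘ e.symm =ᶠ[nhds y] (f ∘ e'.symm) ∘ (e' ∘ e.symm) := by
    have : ∀ᶠ z in nhds y, e.symm z ∈ e'.source :=
      (e.continuousAt_symm hy).eventually (e'.open_source.mem_nhds hy')
    filter_upwards [this] with z hz
    simp [e'.left_inv hz]
  have hg : gram (f ∘ e.symm) y = gram ((f ∘ e'.symm) ∘ (e' ∘ e.symm)) y := by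
    ext i j
    simp only [gram, Matrix.of_apply, pd_congr heq]
  rw [areaDensity_eq, hg, det_gram_comp, Real.sqrt_mul (sq_nonneg _), Real.sqrt_sq_eq_abs,
    areaDensity_eq]
  · exact (contDiffAt_chart he' hf (e'.map_source hy')).differentiableAt (by simp)
  · exact (contDiffAt_transition he he' hy hy').differentiableAt (by simp)

theorem continuousAt_areaDensity (hf : IsOrientedImmersion f N) (he : e ∈ atlas E2 M) {y : E2}
    (hy : y ∈ e.target) : ContinuousAt (areaDensity f e) y := by
  have h := isParamSurface he hf
  have hpd (i : Fin 2) : ContinuousAt (pd i (f ∘ e.symm)) y :=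
    (contDiffAt_pd (h.smooth y hy)).continuousAt
  have hfun : areaDensity f e = fun y => Real.sqrt (gram (f ∘ e.symm) y).det := rfl
  rw [hfun]
  refine ContinuousAt.sqrt ?_
  simp only [gram_det]
  exact (((hpd 0).inner (𝕜 := ℝ) (hpd 0)).mul ((hpd 1).inner (𝕜 := ℝ) (hpd 1))).sub
    (((hpd 0).inner (𝕜 := ℝ) (hpd 1)).pow 2)

end Density

variable [MeasurableSpace M] [BorelSpace M]

theorem measurableSet_target_inter_preimage (e : OpenPartialHomeomorph M E2) {s : Set M}
    (hs : MeasurableSet s) : MeasurableSet (e.target ∩ e.symm ⁻¹' s) := by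
  have := e.open_target.measurableSet.subtype_image
    (e.continuousOn_symm.domRestrict.measurable hs)
  rwa [Set.domRestrict_eq, Set.preimage_comp, Subtype.image_preimage_coe] at this

theorem aemeasurable_symm (f : M → E3) (e : OpenPartialHomeomorph M E2) :
    AEMeasurable e.symm ((volume.restrict e.target).withDensity
      fun y => ENNReal.ofReal (areaDensity f e y)) :=
  (e.continuousOn_symm.aemeasurable e.open_target.measurableSet).mono_ac
    (withDensity_absolutelyContinuous _ _)

theorem chartArea_apply (f : M → E3) (e : OpenPartialHomeomorph M E2) {s : Set M}
    (hs : MeasurableSet s) : chartArea f e s =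
      ∫⁻ y in e.target ∩ e.symm ⁻¹' s, ENNReal.ofReal (areaDensity f e y) := by
  rw [chartArea, Measure.map_apply_of_aemeasurable (aemeasurable_symm f e) hs, withDensity_apply',
    Measure.restrict_restrict' e.open_target.measurableSet, Set.inter_comm]

theorem chartArea_compl_source (f : M → E3) (e : OpenPartialHomeomorph M E2) :
    chartArea f e e.sourceᶜ = 0 := by
  rw [chartArea_apply f e e.open_source.measurableSet.compl]
  have : e.target ∩ e.symm ⁻¹' e.sourceᶜ = ∅ := by
    ext y
    simp only [Set.mem_inter_iff, Set.mem_preimage, Set.mem_compl_iff, Set.mem_empty_iff_false,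
      iff_false, not_and, not_not]
    exact fun hy => e.map_target hy
  rw [this, Measure.restrict_empty, lintegral_zero_measure]

variable [ChartedSpace E2 M] [IsManifold (𝓡 2) ∞ M]

/-- Change of variables along the transition map, whose Jacobian is absorbed by the area density. -/
theorem chartArea_eq_of_subset (hf : ContMDiff (𝓡 2) (𝓡 3) ∞ f) (he : e ∈ atlas E2 M)
    (he' : e' ∈ atlas E2 M) {s : Set M} (hs : MeasurableSet s) (hse : s ⊆ e.source)
    (hse' : s ⊆ e'.source) : chartArea f e s = chartArea f e' s := by
  rw [chartArea_apply f e hs, chartArea_apply f e' hs]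
  have hA := measurableSet_target_inter_preimage e hs
  have himage : e'.target ∩ e'.symm ⁻¹' s = (e' ∘ e.symm) '' (e.target ∩ e.symm ⁻¹' s) := by
    rw [← e'.image_eq_target_inter_inv_preimage hse', ← e.image_eq_target_inter_inv_preimage hse,
      Set.image_comp, Set.LeftInvOn.image_image (e.leftInvOn.mono hse)]
  have hinj : Set.InjOn (e' ∘ e.symm) (e.target ∩ e.symm ⁻¹' s) := by
    intro y hy z hz h
    have := e'.injOn (hse' hy.2) (hse' hz.2) h
    exact e.symm.injOn hy.1 hz.1 this
  have hderiv : ∀ y ∈ e.target ∩ e.symm ⁻¹' s, HasFDerivWithinAt (e' ∘ e.symm)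
      (fderiv ℝ (e' ∘ e.symm) y) (e.target ∩ e.symm ⁻¹' s) y := fun y hy =>
    ((contDiffAt_transition he he' hy.1 (hse' hy.2)).differentiableAt
      (by simp)).hasFDerivAt.hasFDerivWithinAt
  rw [himage, lintegral_image_eq_lintegral_abs_det_fderiv_mul _ hA hderiv hinj]
  refine setLIntegral_congr_fun hA fun y hy => ?_
  rw [areaDensity_transition hf he he' hy.1 (hse' hy.2), ENNReal.ofReal_mul (abs_nonneg _)]

/-- Agreement of the chart measures on overlaps turns the supremum over the atlas into a single
chart measure on each chart domain. -/
theorem area_restrict_source (hf : ContMDiff (𝓡 2) (𝓡 3) ∞ f) (he : e ∈ atlas E2 M) :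
    (area f).restrict e.source = chartArea f e := by
  have hms := e.open_source.measurableSet
  have hself : (chartArea f e).restrict e.source = chartArea f e :=
    Measure.restrict_eq_self_of_ae_mem (chartArea_compl_source f e)
  have hle : chartArea f e ≤ area f := le_iSup₂_of_le e he le_rfl
  apply le_antisymm
  · have hdom : area f ≤ chartArea f e + (area f).restrict e.sourceᶜ := by
      refine iSup₂_le fun e' he' => Measure.le_iff.2 fun s hs => ?_
      have hle' : chartArea f e' ≤ area f := le_iSup₂_of_le e' he' le_rfl
      rw [← measure_inter_add_sdiff s hms, Measure.add_apply, Measure.restrict_apply hs]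
      refine add_le_add ?_ (hle' _)
      have hnull : chartArea f e' (s ∩ e.source) = chartArea f e' (s ∩ e.source ∩ e'.source) := by
        rw [← measure_inter_add_sdiff (s ∩ e.source) e'.open_source.measurableSet]
        rw [measure_mono_null (s := (s ∩ e.source) \ e'.source) (fun x hx => hx.2)
          (chartArea_compl_source f e'), add_zero]
      rw [hnull, chartArea_eq_of_subset hf he' he
        ((hs.inter hms).inter e'.open_source.measurableSet) (fun x hx => hx.2) (fun x hx => hx.1.2)]
      exact measure_mono fun x hx => hx.1.1
    refine (Measure.restrict_mono_measure hdom e.source).trans ?_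
    rw [Measure.restrict_add, hself, Measure.restrict_restrict hms, Set.inter_compl_self,
      Measure.restrict_empty, add_zero]
  · rw [← hself]
    exact Measure.restrict_mono_measure hle _

/-- The density is continuous, hence bounded on compact sets of a chart. This makes continuous
functions with compact support integrable. -/
theorem isLocallyFiniteMeasure_area (hf : IsOrientedImmersion f N) :
    IsLocallyFiniteMeasure (area f) := by
  refine ⟨fun p => ?_⟩
  let e := chartAt E2 p
  have he : e ∈ atlas E2 M := chart_mem_atlas E2 p
  have hp : p ∈ e.source := mem_chart_source E2 p
  obtain ⟨K, hKc, hpK, hKt⟩ := exists_compact_subset e.open_target (e.map_source hp)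
  have hmK : MeasurableSet K := hKc.measurableSet
  refine ⟨e.source ∩ e ⁻¹' interior K, (e.isOpen_inter_preimage isOpen_interior).mem_nhds
    ⟨hp, hpK⟩, ?_⟩
  have hms := (e.isOpen_inter_preimage (isOpen_interior (s := K))).measurableSet
  have h1 : area f (e.source ∩ e ⁻¹' interior K) = chartArea f e (e.source ∩ e ⁻¹' interior K) := by
    rw [← area_restrict_source hf.smooth he, Measure.restrict_apply hms,
      Set.inter_eq_left.2 Set.inter_subset_left]
  rw [h1, chartArea_apply f e hms]
  have hint : IntegrableOn (areaDensity f e) K :=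
    ContinuousOn.integrableOn_compact hKc fun y hy =>
      (continuousAt_areaDensity hf he (hKt hy)).continuousWithinAt
  refine lt_of_le_of_lt (lintegral_mono_set ?_) hint.lintegral_lt_top
  rintro y ⟨hy, -, hyK⟩
  have : e (e.symm y) ∈ interior K := hyK
  rw [e.right_inv hy] at this
  exact interior_subset this

theorem integral_area_eq (hf : IsOrientedImmersion f N) (he : e ∈ atlas E2 M) {h : M → ℝ}
    (hh : AEStronglyMeasurable h (area f)) (hsupp : ∀ p ∉ e.source, h p = 0) :
    ∫ p, h p ∂(area f) =
      ∫ y in e.target, Real.sqrt (gram (f ∘ e.symm) y).det * h (e.symm y) := by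
  rw [← setIntegral_eq_integral_of_forall_compl_eq_zero hsupp,
    area_restrict_source hf.smooth he]
  have hh' : AEStronglyMeasurable h (chartArea f e) := by
    rw [← area_restrict_source hf.smooth he]
    exact hh.restrict
  have hdm : AEMeasurable (fun y => ENNReal.ofReal (areaDensity f e y))
      (volume.restrict e.target) :=
    (ContinuousOn.aemeasurable (fun y hy =>
      (continuousAt_areaDensity hf he hy).continuousWithinAt)
      e.open_target.measurableSet).ennreal_ofReal
  rw [chartArea, integral_map (aemeasurable_symm f e) hh',
    integral_withDensity_eq_integral_toReal_smul₀ hdm (by simp)]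
  refine integral_congr_ae (Filter.Eventually.of_forall fun y => ?_)
  simp only [smul_eq_mul, areaDensity_eq]
  rw [ENNReal.toReal_ofReal (Real.sqrt_nonneg _)]

end Area

/-! ### Continuity of the geometric quantities -/

section Continuity

theorem continuousAt_matrix_inv {A : Matrix (Fin 2) (Fin 2) ℝ} (hA : A.det ≠ 0) :
    ContinuousAt (fun B : Matrix (Fin 2) (Fin 2) ℝ => B⁻¹) A := by
  simp only [Matrix.inv_def, Ring.inverse_eq_inv']
  have h1 : Continuous fun B : Matrix (Fin 2) (Fin 2) ℝ => B.det := continuous_id.matrix_det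
  have h2 : Continuous fun B : Matrix (Fin 2) (Fin 2) ℝ => B.adjugate :=
    continuous_id.matrix_adjugate
  exact (h1.continuousAt.inv₀ hA).smul h2.continuousAt

namespace IsParamSurface

variable {U : Set E2} {F N : E2 → E3} {y : E2}

theorem continuousAt_inv_gram (h : IsParamSurface U F N) (hy : y ∈ U) :
    ContinuousAt (fun z => (gram F z)⁻¹) y := by
  have hpd (i : Fin 2) : ContinuousAt (pd i F) y := (contDiffAt_pd (h.smooth y hy)).continuousAt
  have hg : ContinuousAt (gram F) y :=
    continuousAt_pi.2 fun i => continuousAt_pi.2 fun j => (hpd i).inner (𝕜 := ℝ) (hpd j)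
  exact ContinuousAt.comp (f := gram F) (continuousAt_matrix_inv (h.det_ne_zero y hy)) hg

theorem continuousAt_shape (h : IsParamSurface U F N) (hy : y ∈ U) :
    ContinuousAt (fun z => (gram F z)⁻¹ * secondGram F N z) y := by
  have hpd (i : Fin 2) : ContinuousAt (pd i F) y := (contDiffAt_pd (h.smooth y hy)).continuousAt
  have hpdN (i : Fin 2) : ContinuousAt (pd i N) y :=
    (contDiffAt_pd (h.smooth_normal y hy)).continuousAt
  have hg : ContinuousAt (secondGram F N) y :=
    continuousAt_pi.2 fun i => continuousAt_pi.2 fun j => (hpdN i).inner (𝕜 := ℝ) (hpd j)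
  exact (h.continuousAt_inv_gram hy).mul hg

theorem continuousAt_coordMean (h : IsParamSurface U F N) (hy : y ∈ U) :
    ContinuousAt (coordMean F N) y :=
  (continuous_id.matrix_trace.continuousAt).comp (h.continuousAt_shape hy)

theorem continuousAt_coordGauss (h : IsParamSurface U F N) (hy : y ∈ U) :
    ContinuousAt (coordGauss F N) y :=
  (continuous_id.matrix_det.continuousAt).comp (h.continuousAt_shape hy)

theorem continuousAt_gradInner (h : IsParamSurface U F N) (hy : y ∈ U) {a b : E2 → ℝ}
    (ha : ContDiffAt ℝ ∞ a y) (hb : ContDiffAt ℝ ∞ b y) : ContinuousAt (gradInner F a b) y := by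
  have ha' (i : Fin 2) : ContinuousAt (pd i a) y := (contDiffAt_pd ha).continuousAt
  have hb' (i : Fin 2) : ContinuousAt (pd i b) y := (contDiffAt_pd hb).continuousAt
  have hG (i j : Fin 2) : ContinuousAt (fun z => (gram F z)⁻¹ i j) y :=
    continuousAt_pi.1 (continuousAt_pi.1 (h.continuousAt_inv_gram hy) i) j
  unfold gradInner
  simp only [dotProduct, Matrix.mulVec, Fin.sum_univ_two]
  exact ((ha' 0).mul (((hG 0 0).mul (hb' 0)).add ((hG 0 1).mul (hb' 1)))).add
    ((ha' 1).mul (((hG 1 0).mul (hb' 0)).add ((hG 1 1).mul (hb' 1))))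

end IsParamSurface

variable {M : Type*}

theorem height_eq (f : M → E3) (p : M) : height f p = f p 2 := inner_e3 _

theorem angle_eq (N : M → E3) (p : M) : angle N p = N p 2 := inner_e3 _

variable [TopologicalSpace M] [ChartedSpace E2 M]

/-- The geometric quantities are defined with the preferred chart at `p`, which may jump with `p`;
continuity is read off from their expression in one fixed chart near `p`. -/
theorem continuous_of_chart {h : M → ℝ} (k : OpenPartialHomeomorph M E2 → E2 → ℝ)
    (hk : ∀ e ∈ atlas E2 M, ∀ y ∈ e.target, ContinuousAt (k e) y)
    (hhk : ∀ e ∈ atlas E2 M, ∀ p ∈ e.source, h p = k e (e p)) : Continuous h := by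
  rw [continuous_iff_continuousAt]
  intro p
  have hp := mem_chart_source E2 p
  have he := chart_mem_atlas E2 p
  have heq : h =ᶠ[nhds p] k (chartAt E2 p) ∘ chartAt E2 p :=
    Filter.eventually_of_mem ((chartAt E2 p).open_source.mem_nhds hp) (hhk _ he)
  exact (ContinuousAt.comp (hk _ he _ ((chartAt E2 p).map_source hp))
    ((chartAt E2 p).continuousAt hp)).congr heq.symm

theorem angle_sq_le_one {f N : M → E3} (hf : IsOrientedImmersion f N) (p : M) :
    angle N p ^ 2 ≤ 1 := by
  have h := real_inner_self_eq_norm_sq (N p)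
  rw [hf.norm_normal, inner_eq_three] at h
  rw [angle_eq]
  nlinarith [sq_nonneg (N p 0), sq_nonneg (N p 1)]

theorem contMDiff_angle {N : M → E3} (hN : ContMDiff (𝓡 2) (𝓡 3) ∞ N) :
    ContMDiff (𝓡 2) 𝓘(ℝ, ℝ) ∞ (angle N) := by
  have h : ContDiff ℝ ∞ fun x : E3 => ⟪x, e3⟫ := contDiff_id.inner ℝ contDiff_const
  exact h.comp_contMDiff hN

theorem continuous_comp_height {f : M → E3} (hf : ContMDiff (𝓡 2) (𝓡 3) ∞ f) {χ : ℝ → ℝ}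
    (hχ : ∀ p, ContDiffAt ℝ ∞ χ (height f p)) : Continuous fun p => χ (height f p) :=
  continuous_iff_continuousAt.2 fun p => ContinuousAt.comp (f := height f) (hχ p).continuousAt
    (contMDiff_angle hf).continuous.continuousAt

variable [IsManifold (𝓡 2) ∞ M] {f N : M → E3}

theorem continuous_normSqSecondForm (hf : IsOrientedImmersion f N) :
    Continuous (normSqSecondForm f N) := by
  refine continuous_of_chart (fun e y => coordMean (f ∘ e.symm) (N ∘ e.symm) y ^ 2 -
    2 * coordGauss (f ∘ e.symm) (N ∘ e.symm) y) (fun e he y hy => ?_) (fun e he p hp => ?_)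
  · have h := isParamSurface he hf
    exact ((h.continuousAt_coordMean hy).pow 2).sub
      (continuousAt_const.mul (h.continuousAt_coordGauss hy))
  · rw [normSqSecondForm, meanCurvature_eq he hf hp, gaussCurvature_eq he hf hp]

theorem continuous_metric_gradient (hf : IsOrientedImmersion f N) {u v : M → ℝ}
    (hu : ContMDiff (𝓡 2) 𝓘(ℝ, ℝ) ∞ u) (hv : ContMDiff (𝓡 2) 𝓘(ℝ, ℝ) ∞ v) :
    Continuous fun p => metric f p (surfaceGradient f u p) (surfaceGradient f v p) := by
  refine continuous_of_chart (fun e y => gradInner (f ∘ e.symm) (u ∘ e.symm) (v ∘ e.symm) y)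
    (fun e he y hy => ?_) (fun e he p hp => metric_gradient_eq he hf hu hv hp)
  exact (isParamSurface he hf).continuousAt_gradInner hy (contDiffAt_chart he hu hy)
    (contDiffAt_chart he hv hy)

/-- Where `η` vanishes and is minimal, the second fundamental form of a surface with `H = 0`
vanishes. -/
theorem normSqSecondForm_eq_zero (hf : IsOrientedImmersion f N) (hη : ∀ p, 0 ≤ angle N p) {p : M}
    (hp : angle N p = 0) (hH : meanCurvature f N p = 0) : normSqSecondForm f N p = 0 := by
  let e := chartAt E2 p
  have he : e ∈ atlas E2 M := chart_mem_atlas E2 p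
  have hpe : p ∈ e.source := mem_chart_source E2 p
  have h := isParamSurface he hf
  have hy := e.map_source hpe
  have hmin : IsLocalMin (fun z => (N ∘ e.symm) z 2) (e p) := by
    refine Filter.Eventually.of_forall fun z => ?_
    simp only [Function.comp_apply, e.left_inv hpe]
    rw [← angle_eq, ← angle_eq, hp]
    exact hη _
  have hK : gaussCurvature f N p = 0 := by
    rw [gaussCurvature_eq he hf hpe]
    refine h.coordGauss_eq_zero hy ?_ fun i => ?_
    · rw [Function.comp_apply, e.left_inv hpe, ← angle_eq, hp]
    · rw [← pd_apply ((h.smooth_normal _ hy).differentiableAt (by simp)), pd, hmin.fderiv_eq_zero]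
      rfl
  rw [normSqSecondForm, hH, hK]
  ring

end Continuity

/-! ### The weak equation for the angle function -/

section Weak

open MeasureTheory

variable {M : Type*} [TopologicalSpace M] [ChartedSpace E2 M]

/-- The coordinates of `du` in the standard basis of `T_pM`. -/
def covector (u : M → ℝ) (p : M) : Fin 2 → ℝ := fun j => diffFun u p (tangentBasis p j)

/-- The integrand of the weak form of `div (e^φ ∇η) + e^φ (|𝒮|² + φ''(1 - η²)) η = 0`. -/
def weakIntegrand (φ : ℝ → ℝ) (f N : M → E3) (ψ : M → ℝ) (p : M) : ℝ :=
  Real.exp (φ (height f p)) * (metric f p (surfaceGradient f ψ p) (surfaceGradient f (angle N) p) -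
    ψ p * (normSqSecondForm f N p + deriv (deriv φ) (height f p) * (1 - angle N p ^ 2)) *
      angle N p)

theorem metric_gradient_eq_zero {f N : M → E3} (hf : IsOrientedImmersion f N) {u : M → ℝ}
    (v : M → ℝ) {p : M} (hp : p ∉ tsupport u) :
    metric f p (surfaceGradient f u p) (surfaceGradient f v p) = 0 := by
  have h0 : diffFun u p = 0 := by
    have : u =ᶠ[nhds p] fun _ => (0 : ℝ) := notMem_tsupport_iff_eventuallyEq.1 hp
    rw [diffFun, this.mfderiv_eq, mfderiv_const]
    rfl
  rw [metric_gradient_eq_dotProduct hf, h0]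
  simp [dotProduct]

theorem weakIntegrand_eq_zero {φ : ℝ → ℝ} {f N : M → E3} (hf : IsOrientedImmersion f N)
    {ψ : M → ℝ} {p : M} (hp : p ∉ tsupport ψ) : weakIntegrand φ f N ψ p = 0 := by
  rw [weakIntegrand, metric_gradient_eq_zero hf _ hp, image_eq_zero_of_notMem_tsupport hp]
  ring

variable [IsManifold (𝓡 2) ∞ M]

theorem covector_eq {u : M → ℝ} (hu : ContMDiff (𝓡 2) 𝓘(ℝ, ℝ) ∞ u) (p : M) : covector u p =
      (chartMatrix (chartAt E2 p) p).transpose.mulVec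
        fun i => pd i (u ∘ (chartAt E2 p).symm) (chartAt E2 p p) :=
  diffFun_eq (chart_mem_atlas E2 p) hu (mem_chart_source E2 p)

theorem covector_add {u v : M → ℝ} (hu : ContMDiff (𝓡 2) 𝓘(ℝ, ℝ) ∞ u)
    (hv : ContMDiff (𝓡 2) 𝓘(ℝ, ℝ) ∞ v) (p : M) :
    covector (fun q => u q + v q) p = covector u p + covector v p := by
  have hy := (chartAt E2 p).map_source (mem_chart_source E2 p)
  have du := (contDiffAt_chart (chart_mem_atlas E2 p) hu hy).differentiableAt (by simp)
  have dv := (contDiffAt_chart (chart_mem_atlas E2 p) hv hy).differentiableAt (by simp)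
  rw [covector_eq (u := fun q => u q + v q) (hu.add hv), covector_eq hu, covector_eq hv,
    ← Matrix.mulVec_add]
  congr 1
  funext i
  exact pd_add du dv

theorem covector_mul {u v : M → ℝ} (hu : ContMDiff (𝓡 2) 𝓘(ℝ, ℝ) ∞ u)
    (hv : ContMDiff (𝓡 2) 𝓘(ℝ, ℝ) ∞ v) (p : M) :
    covector (fun q => u q * v q) p = u p • covector v p + v p • covector u p := by
  have hp := mem_chart_source E2 p
  have hy := (chartAt E2 p).map_source hp
  have du := (contDiffAt_chart (chart_mem_atlas E2 p) hu hy).differentiableAt (by simp)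
  have dv := (contDiffAt_chart (chart_mem_atlas E2 p) hv hy).differentiableAt (by simp)
  rw [covector_eq (u := fun q => u q * v q) (hu.mul hv), covector_eq hu, covector_eq hv,
    ← Matrix.mulVec_smul, ← Matrix.mulVec_smul, ← Matrix.mulVec_add]
  congr 1
  funext i
  refine (pd_mul du dv).trans ?_
  simp only [Function.comp_apply, (chartAt E2 p).left_inv hp, Pi.add_apply, Pi.smul_apply,
    smul_eq_mul]
  ring

theorem weakIntegrand_add {φ : ℝ → ℝ} {f N : M → E3} (hf : IsOrientedImmersion f N)
    {u v : M → ℝ} (hu : ContMDiff (𝓡 2) 𝓘(ℝ, ℝ) ∞ u)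
    (hv : ContMDiff (𝓡 2) 𝓘(ℝ, ℝ) ∞ v) (p : M) :
    weakIntegrand φ f N (fun q => u q + v q) p =
      weakIntegrand φ f N u p + weakIntegrand φ f N v p := by
  simp only [weakIntegrand, metric_gradient_eq_dotProduct hf]
  have h := covector_add hu hv p
  unfold covector at h
  rw [h, add_dotProduct]
  ring

variable {φ : ℝ → ℝ} {f N : M → E3}

theorem continuous_weakIntegrand (hf : IsOrientedImmersion f N)
    (hφ : ∀ p, ContDiffAt ℝ ∞ φ (height f p)) {ψ : M → ℝ}
    (hψ : ContMDiff (𝓡 2) 𝓘(ℝ, ℝ) ∞ ψ) : Continuous (weakIntegrand φ f N ψ) := by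
  have hη := contMDiff_angle hf.smooth_normal
  have h1 := continuous_comp_height hf.smooth hφ
  have h2 := continuous_comp_height hf.smooth fun p =>
    IsParamSurface.contDiffAt_deriv (IsParamSurface.contDiffAt_deriv (hφ p))
  exact (Real.continuous_exp.comp h1).mul ((continuous_metric_gradient hf hψ hη).sub
    ((hψ.continuous.mul ((continuous_normSqSecondForm hf).add
      (h2.mul (continuous_const.sub (hη.continuous.pow 2))))).mul hη.continuous))

theorem weakTerm_congr {F N : E2 → E3} {ψ χ : E2 → ℝ} {y : E2} (h : ψ =ᶠ[nhds y] χ) :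
    IsParamSurface.weakTerm φ F N ψ y = IsParamSurface.weakTerm φ F N χ y := by
  simp only [IsParamSurface.weakTerm, gradInner, pd_congr h, h.eq_of_nhds]

variable [MeasurableSpace M] [BorelSpace M]

theorem integrable_weakIntegrand (hf : IsOrientedImmersion f N)
    (hφ : ∀ p, ContDiffAt ℝ ∞ φ (height f p)) {ψ : M → ℝ}
    (hψ : ContMDiff (𝓡 2) 𝓘(ℝ, ℝ) ∞ ψ) (hc : HasCompactSupport ψ) :
    Integrable (weakIntegrand φ f N ψ) (area f) := by
  have := isLocallyFiniteMeasure_area hf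
  refine (continuous_weakIntegrand hf hφ hψ).integrable_of_hasCompactSupport
    (HasCompactSupport.intro' hc (isClosed_tsupport ψ) fun p hp => weakIntegrand_eq_zero hf hp)

theorem integral_weakIntegrand_of_chart (hf : IsOrientedImmersion f N)
    (hφ : ∀ p, ContDiffAt ℝ ∞ φ (height f p))
    (hH : ∀ p, meanCurvature f N p = -(deriv φ (height f p) * angle N p))
    {e : OpenPartialHomeomorph M E2} (he : e ∈ atlas E2 M) {ψ : M → ℝ}
    (hψ : ContMDiff (𝓡 2) 𝓘(ℝ, ℝ) ∞ ψ) (hc : HasCompactSupport ψ)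
    (hsupp : tsupport ψ ⊆ e.source) : ∫ p, weakIntegrand φ f N ψ p ∂(area f) = 0 := by
  have h := isParamSurface he hf
  rw [integral_area_eq hf he (integrable_weakIntegrand hf hφ hψ hc).aestronglyMeasurable
    fun p hp => weakIntegrand_eq_zero hf fun hp' => hp (hsupp hp')]
  -- Outside `e.target` the values of `e.symm` are arbitrary, so the test function is extended by
  -- zero.
  let ψ' : E2 → ℝ := e.target.indicator (ψ ∘ e.symm)
  have hψ' : ∀ y ∈ e.target, ψ' =ᶠ[nhds y] ψ ∘ e.symm := fun y hy =>
    Filter.eventually_of_mem (e.open_target.mem_nhds hy) fun z hz => Set.indicator_of_mem hz _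
  have hheight (y : E2) : height f (e.symm y) = (f ∘ e.symm) y 2 := height_eq _ _
  have hangle : angle N ∘ e.symm = fun z => (N ∘ e.symm) z 2 := by
    funext z
    exact angle_eq _ _
  have hterm : ∀ y ∈ e.target, Real.sqrt (gram (f ∘ e.symm) y).det *
      weakIntegrand φ f N ψ (e.symm y) = Real.sqrt (gram (f ∘ e.symm) y).det *
        IsParamSurface.weakTerm φ (f ∘ e.symm) (N ∘ e.symm) ψ' y := fun y hy => by
    have hp := e.map_target hy
    rw [weakTerm_congr (hψ' y hy), weakIntegrand, IsParamSurface.weakTerm,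
      metric_gradient_eq he hf hψ (contMDiff_angle hf.smooth_normal) hp, normSqSecondForm,
      meanCurvature_eq he hf hp, gaussCurvature_eq he hf hp, e.right_inv hy, hangle, hheight,
      angle_eq]
    rfl
  rw [setIntegral_congr_fun e.open_target.measurableSet hterm]
  refine h.integral_weakTerm (fun y _ => ?_) (fun y hy => ?_) (fun y hy => ?_)
    (K := e '' tsupport ψ) ?_ ?_ ?_
  · rw [← hheight]
    exact hφ _
  · have := hH (e.symm y)
    rwa [meanCurvature_eq he hf (e.map_target hy), e.right_inv hy, hheight, angle_eq] at this
  · exact (contDiffAt_chart he hψ hy).congr_of_eventuallyEq (hψ' y hy)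
  · exact IsCompact.image_of_continuousOn hc (e.continuousOn.mono hsupp)
  · rintro _ ⟨p, hp, rfl⟩
    exact e.map_source (hsupp hp)
  · intro y hy
    by_cases hyt : y ∈ e.target
    · simp only [ψ', Set.indicator_of_mem hyt, Function.comp_apply]
      refine image_eq_zero_of_notMem_tsupport fun hp => hy ⟨e.symm y, hp, e.right_inv hyt⟩
    · exact Set.indicator_of_notMem hyt _

variable [T2Space M] [SecondCountableTopology M]

/-- The weak form is additive in the test function, so a partition of unity subordinate to chart
domains reduces it to the case of one chart. -/
theorem integral_weakIntegrand (hf : IsOrientedImmersion f N)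
    (hφ : ∀ p, ContDiffAt ℝ ∞ φ (height f p))
    (hH : ∀ p, meanCurvature f N p = -(deriv φ (height f p) * angle N p)) {ψ : M → ℝ}
    (hψ : ContMDiff (𝓡 2) 𝓘(ℝ, ℝ) ∞ ψ) (hc : HasCompactSupport ψ) :
    ∫ p, weakIntegrand φ f N ψ p ∂(area f) = 0 := by
  have : LocallyCompactSpace M := ChartedSpace.locallyCompactSpace E2 M
  obtain ⟨ρ, hρ⟩ := SmoothPartitionOfUnity.exists_isSubordinate_chartAt_source (𝓡 2) M
  have hfin : {i | (Function.support (ρ i) ∩ tsupport ψ).Nonempty}.Finite :=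
    ρ.locallyFinite.finite_nonempty_inter_compact hc
  have hsum (t : Finset M) : ContMDiff (𝓡 2) 𝓘(ℝ, ℝ) ∞ (fun p => ∑ i ∈ t, ρ i p * ψ p) ∧
      HasCompactSupport (fun p => ∑ i ∈ t, ρ i p * ψ p) ∧
      ∫ p, weakIntegrand φ f N (fun p => ∑ i ∈ t, ρ i p * ψ p) p ∂(area f) = 0 := by
    classical
    induction t using Finset.induction_on with
    | empty =>
      have h0 : (fun p : M => ∑ i ∈ (∅ : Finset M), ρ i p * ψ p) = fun _ => 0 := by simp
      have hs0 : tsupport (fun _ : M => (0 : ℝ)) = ∅ := tsupport_eq_empty_iff.2 rfl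
      rw [h0]
      refine ⟨contMDiff_const, HasCompactSupport.zero, ?_⟩
      rw [integral_congr_ae (Filter.Eventually.of_forall fun p =>
        weakIntegrand_eq_zero hf (by rw [hs0]; exact Set.notMem_empty p)), integral_zero]
    | insert i t hi ih =>
      obtain ⟨h1, h2, h3⟩ := ih
      have g1 : ContMDiff (𝓡 2) 𝓘(ℝ, ℝ) ∞ (fun p => ρ i p * ψ p) := (ρ i).contMDiff.mul hψ
      have g2 : HasCompactSupport (fun p => ρ i p * ψ p) := hc.mul_left
      have g3 : tsupport (fun p => ρ i p * ψ p) ⊆ (chartAt E2 i).source :=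
        (tsupport_mul_subset_left).trans (hρ i)
      have heq : (fun p => ∑ j ∈ insert i t, ρ j p * ψ p) =
          fun p => ρ i p * ψ p + ∑ j ∈ t, ρ j p * ψ p := by
        funext p
        rw [Finset.sum_insert hi]
      rw [heq]
      refine ⟨g1.add h1, g2.add h2, ?_⟩
      rw [integral_congr_ae (Filter.Eventually.of_forall (weakIntegrand_add hf g1 h1)),
        integral_add (integrable_weakIntegrand hf hφ g1 g2)
          (integrable_weakIntegrand hf hφ h1 h2), h3,
        integral_weakIntegrand_of_chart hf hφ hH (chart_mem_atlas E2 i) g1 g2 g3, add_zero]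
  -- Only the finitely many `ρ i` whose support meets the compact `tsupport ψ` matter; where `ψ ≠ 0`
  -- they already sum to one.
  have hψeq : ψ = fun p => ∑ i ∈ hfin.toFinset, ρ i p * ψ p := by
    funext p
    rw [← Finset.sum_mul]
    by_cases hp : ψ p = 0
    · rw [hp, mul_zero]
    · have h1 := ρ.sum_eq_one (Set.mem_univ p)
      rw [finsum_eq_sum_of_support_subset] at h1
      · rw [h1, one_mul]
      · intro i hi
        rw [Set.Finite.coe_toFinset]
        exact ⟨p, hi, subset_tsupport _ hp⟩
  rw [hψeq]
  exact (hsum _).2.2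

end Weak

/-! ### Stability -/

section Stability

open MeasureTheory

theorem isOpen_coe_gt (α : WithBot ℝ) : IsOpen {z : ℝ | α < (z : WithBot ℝ)} := by
  induction α using WithBot.recBotCoe with
  | bot => simp
  | coe a =>
    simp only [WithBot.coe_lt_coe]
    exact isOpen_Ioi

variable {M : Type*} [TopologicalSpace M] [ChartedSpace E2 M] {φ : ℝ → ℝ} {f N : M → E3}

/-- By the chain rule the gradient of `x ↦ φ ⟨x, e₃⟩` is `φ'(⟨x, e₃⟩) e₃`. -/
theorem IsPhiMinimal.meanCurvature_eq_neg (hmin : IsPhiMinimal φ f N) {p : M}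
    (hφ : ContDiffAt ℝ ∞ φ (height f p)) :
    meanCurvature f N p = -(deriv φ (height f p) * angle N p) := by
  have hd : HasFDerivAt (fun x : E3 => ⟪x, e3⟫) (innerSL ℝ e3) (f p) := by
    have := (innerSL ℝ e3).hasFDerivAt (x := f p)
    refine this.congr_of_eventuallyEq (Filter.Eventually.of_forall fun x => ?_)
    exact real_inner_comm _ _
  have hc := ((hφ.differentiableAt (by simp)).hasDerivAt (x := height f p)).comp_hasFDerivAt
    (f p) hd
  rw [hmin p, inner_gradient_left]
  change -(fderiv ℝ (φ ∘ fun x : E3 => ⟪x, e3⟫) (f p) (N p)) = _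
  rw [hc.fderiv, angle, real_inner_comm]
  rfl

theorem continuous_stabilityIntegrand [IsManifold (𝓡 2) ∞ M] (hf : IsOrientedImmersion f N)
    (hφ : ∀ p, ContDiffAt ℝ ∞ φ (height f p)) {u : M → ℝ}
    (hu : ContMDiff (𝓡 2) 𝓘(ℝ, ℝ) ∞ u) : Continuous (stabilityIntegrand φ f N u u) := by
  have hη := contMDiff_angle hf.smooth_normal
  have h1 := continuous_comp_height hf.smooth hφ
  have h2 := continuous_comp_height hf.smooth fun p =>
    IsParamSurface.contDiffAt_deriv (IsParamSurface.contDiffAt_deriv (hφ p))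
  exact (Real.continuous_exp.comp h1).mul ((continuous_metric_gradient hf hu hu).sub
    (((continuous_normSqSecondForm hf).sub (h2.mul (hη.continuous.pow 2))).mul
      (hu.continuous.mul hu.continuous)))

/-- The inequality `⟨∇(ζ²w), ∇w⟩ ≤ |∇(ζw)|²`. -/
theorem metric_gradient_le [IsManifold (𝓡 2) ∞ M] (hf : IsOrientedImmersion f N) {ζ w : M → ℝ}
    (hζ : ContMDiff (𝓡 2) 𝓘(ℝ, ℝ) ∞ ζ) (hw : ContMDiff (𝓡 2) 𝓘(ℝ, ℝ) ∞ w) (p : M) :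
    metric f p (surfaceGradient f (fun q => ζ q * (ζ q * w q)) p) (surfaceGradient f w p) ≤
      metric f p (surfaceGradient f (fun q => ζ q * w q) p)
        (surfaceGradient f (fun q => ζ q * w q) p) := by
  have hpos : 0 ≤ metric f p (surfaceGradient f ζ p) (surfaceGradient f ζ p) :=
    real_inner_self_nonneg
  have hsymm : metric f p (surfaceGradient f ζ p) (surfaceGradient f w p) =
      metric f p (surfaceGradient f w p) (surfaceGradient f ζ p) := real_inner_comm _ _
  have h1 := covector_mul hζ hw p
  have h2 := covector_mul (v := fun q => ζ q * w q) hζ (hζ.mul hw) p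
  rw [metric_gradient_eq_dotProduct hf] at hpos hsymm ⊢
  rw [metric_gradient_eq_dotProduct hf] at hsymm ⊢
  change covector ζ p ⬝ᵥ (metricMatrix f p)⁻¹.mulVec (covector w p) =
    covector w p ⬝ᵥ (metricMatrix f p)⁻¹.mulVec (covector ζ p) at hsymm
  change 0 ≤ covector ζ p ⬝ᵥ (metricMatrix f p)⁻¹.mulVec (covector ζ p) at hpos
  change covector (fun q => ζ q * (ζ q * w q)) p ⬝ᵥ (metricMatrix f p)⁻¹.mulVec (covector w p) ≤
    covector (fun q => ζ q * w q) p ⬝ᵥ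
      (metricMatrix f p)⁻¹.mulVec (covector (fun q => ζ q * w q) p)
  rw [h2, h1]
  simp only [Matrix.mulVec_add, Matrix.mulVec_smul, dotProduct_add, add_dotProduct,
    smul_dotProduct, dotProduct_smul, smul_eq_mul, smul_add]
  rw [← hsymm]
  -- The difference of the two sides is `w² |∇ζ|²`.
  nlinarith [mul_nonneg (sq_nonneg (w p)) hpos]

theorem metric_gradient_add_const [IsManifold (𝓡 2) ∞ M] (hf : IsOrientedImmersion f N)
    (ψ : M → ℝ) {w : M → ℝ} (hw : ContMDiff (𝓡 2) 𝓘(ℝ, ℝ) ∞ w) (c : ℝ) (p : M) :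
    metric f p (surfaceGradient f ψ p) (surfaceGradient f (fun q => w q + c) p) =
      metric f p (surfaceGradient f ψ p) (surfaceGradient f w p) := by
  have hc : covector (fun _ : M => c) p = 0 := by
    funext j
    simp only [covector, diffFun, mfderiv_const]
    rfl
  have h := covector_add hw (contMDiff_const (c := c)) p
  rw [hc, add_zero] at h
  rw [metric_gradient_eq_dotProduct hf, metric_gradient_eq_dotProduct hf]
  change _ ⬝ᵥ (metricMatrix f p)⁻¹.mulVec (covector (fun q => w q + c) p) = _
  rw [h]
  rfl

variable [IsManifold (𝓡 2) ∞ M] [MeasurableSpace M] [BorelSpace M]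

theorem integrable_of_continuous_of_tsupport (hf : IsOrientedImmersion f N) {h u : M → ℝ}
    (hh : Continuous h) (hu : HasCompactSupport u) (h0 : ∀ p ∉ tsupport u, h p = 0) :
    Integrable h (area f) := by
  have := isLocallyFiniteMeasure_area hf
  exact hh.integrable_of_hasCompactSupport
    (HasCompactSupport.intro' hu (isClosed_tsupport u) h0)

variable [T2Space M] [SecondCountableTopology M]

/-- A lower bound for the stability form from the supersolution `η + ε`. -/
theorem neg_integral_le_stabilityForm (hf : IsOrientedImmersion f N)
    (hφ : ∀ p, ContDiffAt ℝ ∞ φ (height f p)) (hφ'' : ∀ p, 0 ≤ deriv (deriv φ) (height f p))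
    (hH : ∀ p, meanCurvature f N p = -(deriv φ (height f p) * angle N p))
    (hη : ∀ p, 0 ≤ angle N p) {u : M → ℝ} (hu : ContMDiff (𝓡 2) 𝓘(ℝ, ℝ) ∞ u)
    (hc : HasCompactSupport u) {ε : ℝ} (hε : 0 < ε) :
    -∫ p, Real.exp (φ (height f p)) * u p ^ 2 * normSqSecondForm f N p *
      (ε / (angle N p + ε)) ∂(area f) ≤ stabilityForm φ f N u u := by
  have hηs := contMDiff_angle hf.smooth_normal
  have hw : ContMDiff (𝓡 2) 𝓘(ℝ, ℝ) ∞ fun p => angle N p + ε := hηs.add contMDiff_const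
  have hwpos : ∀ p, 0 < angle N p + ε := fun p => add_pos_of_nonneg_of_pos (hη p) hε
  have hζ : ContMDiff (𝓡 2) 𝓘(ℝ, ℝ) ∞ fun p => u p * (angle N p + ε)⁻¹ :=
    hu.mul (hw.inv₀ fun p => (hwpos p).ne')
  have hu_eq : (fun q => u q * (angle N q + ε)⁻¹ * (angle N q + ε)) = u := by
    funext q
    rw [mul_assoc, inv_mul_cancel₀ (hwpos q).ne', mul_one]
  -- `ψ = u²/(η + ε) = ζ² w` with `w = η + ε` and `ζ = u/w`; also `∇w = ∇η`.
  let ψ : M → ℝ := fun p => u p * (angle N p + ε)⁻¹ * u p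
  have hψ : ContMDiff (𝓡 2) 𝓘(ℝ, ℝ) ∞ ψ := hζ.mul hu
  have hψc : HasCompactSupport ψ := hc.mul_left
  have hgrad : ∀ p, metric f p (surfaceGradient f ψ p) (surfaceGradient f (angle N) p) ≤
      metric f p (surfaceGradient f u p) (surfaceGradient f u p) := by
    intro p
    have h := metric_gradient_le hf hζ hw p
    have h' : (fun q => u q * (angle N q + ε)⁻¹ * (u q * (angle N q + ε)⁻¹ * (angle N q + ε))) =
        ψ := by
      funext q
      rw [congrFun hu_eq q]
    rwa [hu_eq, h', metric_gradient_add_const hf ψ hηs] at h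
  have hpoint : ∀ p, weakIntegrand φ f N ψ p - Real.exp (φ (height f p)) * u p ^ 2 *
      normSqSecondForm f N p * (ε / (angle N p + ε)) ≤ stabilityIntegrand φ f N u u p := by
    intro p
    have hE := Real.exp_pos (φ (height f p))
    have hη1 := angle_sq_le_one hf p
    have hquot : ε / (angle N p + ε) = 1 - angle N p * (angle N p + ε)⁻¹ := by
      have := (hwpos p).ne'
      field_simp
      ring
    -- These are the `φ''` terms left over when the two integrands are compared, up to `e^φ`. The
    -- `|𝒮|²` terms combine to the error with factor `1 - η/(η + ε) = ε/(η + ε)`.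
    have hnn : 0 ≤ u p ^ 2 * deriv (deriv φ) (height f p) *
        ((1 - angle N p ^ 2) * (angle N p * (angle N p + ε)⁻¹) + angle N p ^ 2) := by
      have h1 : 0 ≤ angle N p * (angle N p + ε)⁻¹ :=
        mul_nonneg (hη p) (inv_nonneg.2 (hwpos p).le)
      have h2 : 0 ≤ 1 - angle N p ^ 2 := by linarith
      have h3 := hφ'' p
      positivity
    rw [hquot, weakIntegrand, stabilityIntegrand]
    simp only [ψ]
    nlinarith [mul_le_mul_of_nonneg_left (hgrad p) hE.le, mul_nonneg hE.le hnn]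
  have hcont : Continuous fun p => Real.exp (φ (height f p)) * u p ^ 2 *
      normSqSecondForm f N p * (ε / (angle N p + ε)) :=
    (((Real.continuous_exp.comp (continuous_comp_height hf.smooth hφ)).mul
      (hu.continuous.pow 2)).mul (continuous_normSqSecondForm hf)).mul
      (continuous_const.div hw.continuous fun p => (hwpos p).ne')
  have hint := integrable_of_continuous_of_tsupport hf hcont hc fun p hp => by
    simp [image_eq_zero_of_notMem_tsupport hp]
  have hQ := integrable_of_continuous_of_tsupport hf (continuous_stabilityIntegrand hf hφ hu) hc
    fun p hp => by
      simp [stabilityIntegrand, metric_gradient_eq_zero hf _ hp,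
        image_eq_zero_of_notMem_tsupport hp]
  have hW := integrable_weakIntegrand hf hφ hψ hψc
  have h := integral_mono (hW.sub hint) hQ hpoint
  simp only [Pi.sub_apply] at h
  rw [integral_sub hW hint, integral_weakIntegrand hf hφ hH hψ hψc, zero_sub] at h
  exact h

/-- Let `ε → 0` in the lower bound: `|g|` dominates because `0 ≤ ε/(η + ε) ≤ 1`. -/
theorem isStable_of_angle_nonneg (hf : IsOrientedImmersion f N)
    (hφ : ∀ p, ContDiffAt ℝ ∞ φ (height f p)) (hφ'' : ∀ p, 0 ≤ deriv (deriv φ) (height f p))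
    (hH : ∀ p, meanCurvature f N p = -(deriv φ (height f p) * angle N p))
    (hη : ∀ p, 0 ≤ angle N p) : IsStable φ f N := by
  intro u hu hc
  refine ⟨integrable_of_continuous_of_tsupport hf (continuous_stabilityIntegrand hf hφ hu) hc
    fun p hp => by
      simp [stabilityIntegrand, metric_gradient_eq_zero hf _ hp,
        image_eq_zero_of_notMem_tsupport hp], ?_⟩
  have hηs := contMDiff_angle hf.smooth_normal
  let g : M → ℝ := fun p => Real.exp (φ (height f p)) * u p ^ 2 * normSqSecondForm f N p
  have hg : Continuous g :=
    ((Real.continuous_exp.comp (continuous_comp_height hf.smooth hφ)).mul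
      (hu.continuous.pow 2)).mul (continuous_normSqSecondForm hf)
  have hgi : Integrable g (area f) := integrable_of_continuous_of_tsupport hf hg hc fun p hp => by
    simp [g, image_eq_zero_of_notMem_tsupport hp]
  let ε : ℕ → ℝ := fun n => 1 / ((n : ℝ) + 1)
  have hε : ∀ n, 0 < ε n := fun n => Nat.one_div_pos_of_nat
  have hε0 : Filter.Tendsto ε Filter.atTop (nhds 0) := tendsto_one_div_add_atTop_nhds_zero_nat
  have hlim : Filter.Tendsto (fun n => ∫ p, g p * (ε n / (angle N p + ε n)) ∂(area f))
      Filter.atTop (nhds (∫ _, (0 : ℝ) ∂(area f))) := by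
    refine tendsto_integral_of_dominated_convergence (fun p => ‖g p‖) (fun n => ?_) hgi.norm
      (fun n => Filter.Eventually.of_forall fun p => ?_)
      (Filter.Eventually.of_forall fun p => ?_)
    · exact hgi.aestronglyMeasurable.mul ((continuous_const.div
        (hηs.continuous.add continuous_const) fun p =>
          (add_pos_of_nonneg_of_pos (hη p) (hε n)).ne').measurable.aestronglyMeasurable)
    · rw [norm_mul]
      refine mul_le_of_le_one_right (norm_nonneg _) ?_
      have hpos := add_pos_of_nonneg_of_pos (hη p) (hε n)
      rw [Real.norm_of_nonneg (div_nonneg (hε n).le hpos.le), div_le_one hpos]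
      linarith [hη p]
    -- At zeros of `η` the quotient is constantly `1`, and convergence comes instead from `|𝒮|² = 0`
    -- there.
    · rcases (hη p).eq_or_lt with h0 | hpos
      · have hS := normSqSecondForm_eq_zero hf hη h0.symm (by rw [hH p, ← h0]; ring)
        simp [g, hS]
      · have h1 : Filter.Tendsto (fun n => ε n / (angle N p + ε n)) Filter.atTop
            (nhds (0 / (angle N p + 0))) :=
          hε0.div (tendsto_const_nhds.add hε0) (by rw [add_zero]; exact hpos.ne')
        simpa using h1.const_mul (g p)
  rw [integral_zero] at hlim
  refine le_of_tendsto' (by simpa using hlim.neg) fun n =>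
    neg_integral_le_stabilityForm hf hφ hφ'' hH hη hu hc (hε n)

end Stability

end PhiMinimal

end

/-! ### From the sign of the mean curvature to the sign of the angle function -/

theorem mainTheorem5
    {M : Type*} [TopologicalSpace M] [ChartedSpace PhiMinimal.E2 M] [IsManifold (𝓡 2) ∞ M]
    [T2Space M] [SecondCountableTopology M] [MeasurableSpace M] [BorelSpace M]
    (α : WithBot ℝ) (φ : ℝ → ℝ)
    (hφ : ContDiffOn ℝ ∞ φ {z : ℝ | α < (z : WithBot ℝ)})
    (hφ' : ∀ z : ℝ, α < (z : WithBot ℝ) → 0 < deriv φ z)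
    (hφ'' : ∀ z : ℝ, α < (z : WithBot ℝ) → 0 ≤ deriv (deriv φ) z)
    (f N : M → PhiMinimal.E3)
    (hf : PhiMinimal.IsOrientedImmersion f N)
    (hα : ∀ p, f p ∈ PhiMinimal.upperRegion α)
    (hmin : PhiMinimal.IsPhiMinimal φ f N)
    (hH : ∀ p, PhiMinimal.meanCurvature f N p ≤ 0) :
    PhiMinimal.IsStable φ f N := by
  have hφs : ∀ p, ContDiffAt ℝ ∞ φ (PhiMinimal.height f p) := fun p =>
    hφ.contDiffAt ((PhiMinimal.isOpen_coe_gt α).mem_nhds (hα p))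
  have hHm := fun p => hmin.meanCurvature_eq_neg (hφs p)
  refine PhiMinimal.isStable_of_angle_nonneg hf hφs (fun p => hφ'' _ (hα p)) hHm fun p => ?_
  have h := hH p
  rw [hHm p, neg_nonpos] at h
  exact nonneg_of_mul_nonneg_right h (hφ' _ (hα p))
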